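/- Let $V_0$ be the non-symmetric operad of sets with $V_0(0)=\{0\}$, $V_0(1)=\{1\}$ and, for $n\ge 2$, $V_0(n)=\coprod_{k=1}^{n-1}V_0(k)\times V_0(n-k)$ (the complete parenthesizations of a list of $n$ letters). Set $\beta\cdot 0=\beta=0\cdot\beta$ and $\beta_1\cdot\beta_2=(\beta_1,\beta_2)$ for $\beta_1,\beta_2\ne 0$. The identity is $1$, and composition is given recursively by $\Gamma(0;)=0$, $\Gamma(1;\alpha)=\alpha$ and $\Gamma((\beta_1,\beta_2);\alpha_1,\dots,\alpha_n)=\Gamma(\beta_1;\alpha_1,\dots,\alpha_k)\cdot\Gamma(\beta_2;\alpha_{k+1},\dots,\alpha_n)$ for $\beta_1\in V_0(k)$. Let $LV_0$ be the free symmetric operad on $V_0$, so that $LV_0(n)=V_0(n)\times\Sigma_n$ with $\Sigma_n$ acting by right multiplication, and let $ELV_0$ be the categorical operad (operad in categories) whose $n$-th category has object set $LV_0(n)$ and exactly one morphism between any two objects. A strictly unital symmetric monoidal category is a symmetric monoidal category in which $e\otimes a=a=a\otimes e$ and the left and right unit isomorphisms are identities. Then, for every category $\mathcal C$, strictly unital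 symmetric monoidal structures on $\mathcal C$ correspond bijectively to $ELV_0$-algebra structures on $\mathcal C$. The structure corresponding to an algebra structure has as unit the action of $0$, as product the action of $(1,1)$, as associativity isomorphism $(a\otimes b)\otimes c\cong a\otimes(b\otimes c)$ the action of the unique isomorphism $((1,1),1)\cong(1,(1,1))$ in $ELV_0(3)$, and as commutativity isomorphism $a\otimes b\cong b\otimes a$ the action of the unique isomorphism $((1,1),\mathrm{id})\cong((1,1),t)$ in $ELV_0(2)$, where $t\in\Sigma_2$ is the transposition. Moreover, this bijection extends to an isomorphism, compatible with the functors to underlying categories, between the category of $ELV_0$-algebras (and functors commuting strictly with the actions) and the category of strictly unital symmetric monoidal categories and strict maps (functors preserving the unit, the product and all structure isomorphisms on the nose). -/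

import Mathlib

open CategoryTheory MonoidalCategory

universe w t v u

namespace OperadSMC

/-- The lexicographic identification of a concatenation of blocks of lengths `k 0, k 1, …` with
`Fin m`, where `m` is the sum of the lengths: the `j`-th letter of block `i` has position
`k 0 + ⋯ + k (i - 1) + j`. -/
def blockEquiv {n m : ℕ} (k : Fin n → ℕ) (h : ∑ i, k i = m) :
    (Σ i : Fin n, Fin (k i)) ≃ Fin m :=
  finSigmaFinEquiv.trans (finCongr h)

theorem blockEquiv_val {n m : ℕ} (k : Fin n → ℕ) (h : ∑ i, k i = m)
    (x : Σ i : Fin n, Fin (k i)) :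
    (blockEquiv k h x : ℕ) = ∑ i : Fin x.1.val, k (Fin.castLE x.1.2.le i) + x.2 :=
  finSigmaFinEquiv_apply x

theorem blockEquiv_val' {n m : ℕ} (k : Fin n → ℕ) (h : ∑ i, k i = m)
    (x : Σ i : Fin n, Fin (k i)) :
    (blockEquiv k h x : ℕ) = ∑ i ∈ Finset.Iio x.1, k i + x.2 := by
  rw [blockEquiv_val]
  congr 1
  refine Finset.sum_bij (fun i _ => Fin.castLE x.1.2.le i) ?_ ?_ ?_ ?_
  · intro a _
    rw [Finset.mem_Iio, Fin.lt_def]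
    exact a.2
  · intro a _ b _ hab
    simpa [Fin.ext_iff] using hab
  · intro b hb
    exact ⟨⟨b.1, by
      rw [Finset.mem_Iio, Fin.lt_def] at hb
      exact hb⟩, Finset.mem_univ _, rfl⟩
  · intro a _
    rfl

theorem blockEquiv_lt_aux {n m : ℕ} (k : Fin n → ℕ) (h : ∑ i, k i = m)
    (x y : Σ i : Fin n, Fin (k i))
    (hxy : x.1 < y.1 ∨ (x.1 = y.1 ∧ (x.2 : ℕ) < y.2)) :
    blockEquiv k h x < blockEquiv k h y := by
  rw [Fin.lt_def, blockEquiv_val', blockEquiv_val']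
  rcases hxy with hxy | ⟨h1, h2⟩
  · have h3 : ∑ i ∈ Finset.Iio x.1, k i + k x.1 = ∑ i ∈ Finset.Iic x.1, k i := by
      rw [← Finset.Iio_insert, Finset.sum_insert (by simp), add_comm]
    have h4 : ∑ i ∈ Finset.Iic x.1, k i ≤ ∑ i ∈ Finset.Iio y.1, k i :=
      Finset.sum_le_sum_of_subset (fun i hi => by
        simp only [Finset.mem_Iic, Finset.mem_Iio] at *
        exact lt_of_le_of_lt hi hxy)
    have h5 := x.2.2
    omega
  · have h3 : ∑ i ∈ Finset.Iio x.1, k i = ∑ i ∈ Finset.Iio y.1, k i := by rw [h1]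
    omega

theorem blockEquiv_lt {n m : ℕ} (k : Fin n → ℕ) (h : ∑ i, k i = m)
    (x y : Σ i : Fin n, Fin (k i)) :
    blockEquiv k h x < blockEquiv k h y ↔
      x.1 < y.1 ∨ (x.1 = y.1 ∧ (x.2 : ℕ) < y.2) := by
  refine ⟨fun hlt => ?_, blockEquiv_lt_aux k h x y⟩
  by_contra hcon
  rcases eq_or_ne x y with rfl | hne
  · exact lt_irrefl _ hlt
  · refine lt_asymm hlt (blockEquiv_lt_aux k h y x ?_)
    rcases lt_trichotomy x.1 y.1 with h1 | h1 | h1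
    · exact absurd (Or.inl h1) hcon
    · rcases lt_trichotomy (x.2 : ℕ) y.2 with h2 | h2 | h2
      · exact absurd (Or.inr ⟨h1, h2⟩) hcon
      · exfalso
        apply hne
        obtain ⟨i, a⟩ := x
        obtain ⟨i', a'⟩ := y
        obtain rfl : i = i' := h1
        obtain rfl : a = a' := Fin.ext h2
        rfl
      · exact Or.inr ⟨h1.symm, h2⟩
    · exact Or.inl h1

theorem equiv_eq_of_lt_iff {X : Type*} {p : ℕ} (e f : X ≃ Fin p)
    (h : ∀ x y, e x < e y ↔ f x < f y) : e = f := by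
  let g : Fin p ≃o Fin p :=
    { toEquiv := e.symm.trans f
      map_rel_iff' := by
        intro a b
        have := h (e.symm b) (e.symm a)
        simp only [Equiv.apply_symm_apply] at this
        simp only [Equiv.trans_apply]
        rw [← not_lt, ← not_lt, this] }
  have hg : g = OrderIso.refl _ := Subsingleton.elim _ _
  ext x
  have := congrArg (fun t : Fin p ≃o Fin p => t (e x)) hg
  simp only [OrderIso.refl_apply] at this
  rw [← this]
  simp [g]

/-- Flattening a two-fold subdivision into blocks does not depend on the order of flattening. -/
theorem blockEquiv_assoc {n m p : ℕ} (k : Fin n → ℕ) (h : ∑ i, k i = m)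
    (l : (Σ i : Fin n, Fin (k i)) → ℕ) (d : Fin n → ℕ)
    (hd : ∀ i, ∑ j, l ⟨i, j⟩ = d i) (hp : ∑ i, d i = p)
    (hl : ∑ b, l ((blockEquiv k h).symm b) = p)
    (b : Fin m) (t : Fin (l ((blockEquiv k h).symm b))) :
    blockEquiv (fun b => l ((blockEquiv k h).symm b)) hl ⟨b, t⟩ =
      blockEquiv d hp ⟨((blockEquiv k h).symm b).1,
        blockEquiv (fun j => l ⟨((blockEquiv k h).symm b).1, j⟩) (hd _)
          ⟨((blockEquiv k h).symm b).2, t⟩⟩ := by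
  let e := blockEquiv (fun b => l ((blockEquiv k h).symm b)) hl
  let f : (Σ b : Fin m, Fin (l ((blockEquiv k h).symm b))) ≃ Fin p :=
    ((Equiv.sigmaCongrLeft' (β := fun x => Fin (l x)) (blockEquiv k h)).symm.trans
      (Equiv.sigmaAssoc (fun i j => Fin (l ⟨i, j⟩)))).trans
      ((Equiv.sigmaCongrRight fun i => blockEquiv (fun j => l ⟨i, j⟩) (hd i)).trans
        (blockEquiv d hp))
  have hf : ∀ x, f x = blockEquiv d hp ⟨((blockEquiv k h).symm x.1).1,
        blockEquiv (fun j => l ⟨((blockEquiv k h).symm x.1).1, j⟩) (hd _)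
          ⟨((blockEquiv k h).symm x.1).2, x.2⟩⟩ := fun x => rfl
  have key : e = f := by
    refine equiv_eq_of_lt_iff e f ?_
    rintro ⟨b, t⟩ ⟨b', t'⟩
    rw [hf, hf]
    have hb := blockEquiv_lt k h ((blockEquiv k h).symm b) ((blockEquiv k h).symm b')
    rw [Equiv.apply_symm_apply, Equiv.apply_symm_apply] at hb
    have inj : b = b' ↔ ((blockEquiv k h).symm b).1 = ((blockEquiv k h).symm b').1 ∧
        (((blockEquiv k h).symm b).2 : ℕ) = ((blockEquiv k h).symm b').2 := by
      rw [← (blockEquiv k h).symm.injective.eq_iff]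
      generalize (blockEquiv k h).symm b = x
      generalize (blockEquiv k h).symm b' = y
      obtain ⟨i, j⟩ := x
      obtain ⟨i', j'⟩ := y
      constructor
      · rintro ⟨⟩
        exact ⟨rfl, rfl⟩
      · rintro ⟨h1, h2⟩
        obtain rfl : i = i' := h1
        obtain rfl : j = j' := Fin.ext h2
        rfl
    have gen : ∀ (x y : Σ i : Fin n, Fin (k i)) (tx : Fin (l x)) (ty : Fin (l y)),
        (x.1 < y.1 ∨ x.1 = y.1 ∧
          ((blockEquiv (fun j => l ⟨x.1, j⟩) (hd _) ⟨x.2, tx⟩ : Fin _) : ℕ) <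
            (blockEquiv (fun j => l ⟨y.1, j⟩) (hd _) ⟨y.2, ty⟩ : Fin _)) ↔
        (x.1 < y.1 ∨ x.1 = y.1 ∧ ((x.2 : ℕ) < y.2 ∨ (x.2 : ℕ) = y.2 ∧ (tx : ℕ) < ty)) := by
      rintro ⟨i, j⟩ ⟨i', j'⟩ tx ty
      by_cases hi : i = i'
      · subst hi
        have := blockEquiv_lt (fun j => l ⟨i, j⟩) (hd i) ⟨j, tx⟩ ⟨j', ty⟩
        simp only [lt_irrefl, false_or, true_and]
        rw [← Fin.lt_def, this, ← Fin.ext_iff, Fin.lt_def]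
      · simp [hi]
    have h1 : e ⟨b, t⟩ < e ⟨b', t'⟩ ↔ b < b' ∨ (b = b' ∧ (t : ℕ) < t') :=
      blockEquiv_lt _ hl ⟨b, t⟩ ⟨b', t'⟩
    have h2 := gen ((blockEquiv k h).symm b) ((blockEquiv k h).symm b') t t'
    rw [h1, blockEquiv_lt]
    refine Iff.trans ?_ h2.symm
    rw [hb, inj]
    rw [and_or_left, or_assoc, and_assoc]
  have := congrArg (fun g : (Σ b : Fin m, Fin (l ((blockEquiv k h).symm b))) ≃ Fin p =>
    g ⟨b, t⟩) key
  exact this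

/-! ### Non-symmetric operads of sets -/

/-- A non-symmetric operad of sets. The composition `Γ(q; r₀, …, rₙ₋₁)` lies in degree
`∑ i, k i`; it is written with values in degree `m` for any `m` that comes with a proof of
`∑ i, k i = m`, so that no transport between degrees appears in the axioms. -/
structure NSOperad where
  Op : ℕ → Type w
  one : Op 1
  comp : ∀ {n m : ℕ} (k : Fin n → ℕ), ∑ i, k i = m → Op n → (∀ i, Op (k i)) → Op m
  one_comp : ∀ {m : ℕ} (h : ∑ _i : Fin 1, m = m) (q : Op m),
    comp (fun _ => m) h one (fun _ => q) = q
  comp_one : ∀ {n : ℕ} (h : ∑ _i : Fin n, 1 = n) (q : Op n),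
    comp (fun _ => 1) h q (fun _ => one) = q
  comp_assoc : ∀ {n m p : ℕ} (k : Fin n → ℕ) (h : ∑ i, k i = m)
    (l : (Σ i : Fin n, Fin (k i)) → ℕ) (d : Fin n → ℕ)
    (hd : ∀ i, ∑ j, l ⟨i, j⟩ = d i) (hp : ∑ i, d i = p)
    (hl : ∑ b, l ((blockEquiv k h).symm b) = p)
    (q : Op n) (r : ∀ i, Op (k i)) (s : ∀ x, Op (l x)),
    comp (fun b => l ((blockEquiv k h).symm b)) hl (comp k h q r)
        (fun b => s ((blockEquiv k h).symm b)) =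
      comp d hp q (fun i => comp (fun j => l ⟨i, j⟩) (hd i) (r i) (fun j => s ⟨i, j⟩))

/-- `V n` is the set of complete parenthesizations of a list of `n` letters: `V 1` contains `1`,
and every other element of `V n` is a pair of elements of `V j` and `V k` with `j + k = n`. -/
inductive V : ℕ → Type
  | one : V 1
  | pair {j k n : ℕ} (e : j + k = n) (a : V j) (b : V k) : V n

/-- `V₀` adjoins an element `0` in degree `0` to `V` (note that `V 0` is empty). -/
inductive V₀ : ℕ → Type
  | zero : V₀ 0
  | ofV {n : ℕ} (a : V n) : V₀ n

theorem V.pos {n : ℕ} (a : V n) : 0 < n := by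
  induction a with
  | one => exact Nat.one_pos
  | pair e _ _ iha ihb => omega

/-- The operation `V₀ j × V₀ k → V₀ (j + k)`, for which `0` is a strict two-sided unit. -/
def V₀.mul : ∀ {j k n : ℕ}, j + k = n → V₀ j → V₀ k → V₀ n
  | _, _, _, e, .ofV a, .ofV b => .ofV (.pair e a b)
  | _, k, n, e, .zero, b => (show k = n by omega) ▸ b
  | j, _, n, e, a, .zero => (show j = n by omega) ▸ a

theorem sum_split {j k n m : ℕ} (e : j + k = n) (f : Fin n → ℕ) (h : ∑ i, f i = m) :
    ∑ i, f (Fin.cast e (Fin.castAdd k i)) + ∑ i, f (Fin.cast e (Fin.natAdd j i)) = m := by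
  subst e
  rw [← h, Fin.sum_univ_add]
  rfl

/-- Composition with an element of `V`:
`Γ(1; α) = α` and `Γ((a, b); α₁, …, αₙ) = Γ(a; α₁, …, αⱼ) · Γ(b; αⱼ₊₁, …, αₙ)`. -/
def V.comp : ∀ {n m : ℕ} (k : Fin n → ℕ), ∑ i, k i = m → V n → (∀ i, V₀ (k i)) → V₀ m
  | _, m, k, h, .one, r => (show k 0 = m by simpa using h) ▸ r 0
  | _, _, k, h, .pair e a b, r =>
      V₀.mul (sum_split e k h)
        (V.comp (fun i => k (Fin.cast e (Fin.castAdd _ i))) rfl a (fun i => r _))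
        (V.comp (fun i => k (Fin.cast e (Fin.natAdd _ i))) rfl b (fun i => r _))

/-- Composition in `V₀`: additionally `Γ(0;) = 0`. -/
def V₀.comp : ∀ {n m : ℕ} (k : Fin n → ℕ), ∑ i, k i = m → V₀ n → (∀ i, V₀ (k i)) → V₀ m
  | _, m, k, h, .zero, _ => (show 0 = m by simpa using h) ▸ V₀.zero
  | _, _, k, h, .ofV a, r => a.comp k h r

/-! The operad axioms for `V₀` are checked by evaluating parenthesizations in unital magmas. -/

/-- The value of a parenthesization in a magma. -/
def V.eval {M : Type w} [Mul M] : ∀ {n : ℕ}, V n → (Fin n → M) → M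
  | _, .one, x => x 0
  | _, .pair e a b, x =>
      a.eval (fun i => x (Fin.cast e (Fin.castAdd _ i))) *
        b.eval (fun i => x (Fin.cast e (Fin.natAdd _ i)))

/-- The value of an element of `V₀` in a unital magma. -/
def V₀.eval {M : Type w} [MulOneClass M] : ∀ {n : ℕ}, V₀ n → (Fin n → M) → M
  | _, .zero, _ => 1
  | _, .ofV a, x => a.eval x

theorem V₀.eval_cast {M : Type w} [MulOneClass M] {n m : ℕ} (e : n = m) (a : V₀ n)
    (x : Fin m → M) : V₀.eval (e ▸ a) x = a.eval (fun i => x (Fin.cast e i)) := by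
  subst e
  rfl

theorem V₀.eval_mul {M : Type w} [MulOneClass M] {j k n : ℕ} (e : j + k = n) (a : V₀ j)
    (b : V₀ k) (x : Fin n → M) :
    (V₀.mul e a b).eval x =
      a.eval (fun i => x (Fin.cast e (Fin.castAdd _ i))) *
        b.eval (fun i => x (Fin.cast e (Fin.natAdd _ i))) := by
  cases a with
  | zero =>
    obtain rfl : k = n := by omega
    have h1 : V₀.mul e V₀.zero b = b := by cases b <;> rfl
    rw [h1]
    simp only [V₀.eval, one_mul]
    congr 1
    funext i
    congr 1
    ext
    simp
  | ofV a =>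
    cases b with
    | zero =>
      subst e
      simp only [V₀.eval, mul_one]
      rfl
    | ofV b => rfl

theorem V.eval_comp {M : Type w} [MulOneClass M] {n : ℕ} (q : V n) :
    ∀ {m : ℕ} (k : Fin n → ℕ) (h : ∑ i, k i = m) (r : ∀ i, V₀ (k i)) (x : Fin m → M),
    (q.comp k h r).eval x =
      q.eval (fun i => (r i).eval (fun j => x (blockEquiv k h ⟨i, j⟩))) := by
  induction q with
  | one =>
    intro m k h r x
    simp only [V.comp, V.eval]
    rw [V₀.eval_cast]
    congr 1
    funext j
    congr 1
    ext
    rw [blockEquiv_val]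
    simp
  | @pair a b n e qa qb iha ihb =>
    intro m k h r x
    simp only [V.comp, V.eval]
    rw [V₀.eval_mul, iha, ihb]
    subst e
    congr 2
    · funext i
      congr 1
      funext j
      congr 1
      ext
      simp only [Fin.val_cast, Fin.val_castAdd]
      rw [blockEquiv_val, blockEquiv_val]
      rfl
    · funext i
      congr 1
      funext j
      congr 1
      ext
      simp only [Fin.val_cast, Fin.val_natAdd]
      rw [blockEquiv_val, blockEquiv_val, ← add_assoc]
      congr 1
      exact (Fin.sum_univ_add (a := a) (b := i.val) (fun t : Fin (a + i) => k (Fin.castLE (by omega) t))).symm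

theorem V₀.eval_comp {M : Type w} [MulOneClass M] {n m : ℕ} (q : V₀ n)
    (k : Fin n → ℕ) (h : ∑ i, k i = m) (r : ∀ i, V₀ (k i)) (x : Fin m → M) :
    (q.comp k h r).eval x =
      q.eval (fun i => (r i).eval (fun j => x (blockEquiv k h ⟨i, j⟩))) := by
  cases q with
  | zero =>
    simp only [V₀.comp]
    rw [V₀.eval_cast]
    rfl
  | ofV a => exact a.eval_comp k h r x

/-- The unital magma freely generated by one element. -/
abbrev FreeUnitalMagma : Type := WithOne (FreeMagma Unit)

/-- The underlying parenthesization of an element of `V₀`. -/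
def V₀.raw {n : ℕ} (a : V₀ n) : FreeUnitalMagma :=
  a.eval (fun _ => ((FreeMagma.of () : FreeMagma Unit) : FreeUnitalMagma))

/-- The underlying parenthesization of an element of `V`. -/
def V.raw {n : ℕ} (a : V n) : FreeMagma Unit := a.eval (fun _ => FreeMagma.of ())

theorem V.raw_coe {n : ℕ} (a : V n) :
    a.eval (fun _ => ((FreeMagma.of () : FreeMagma Unit) : FreeUnitalMagma)) =
      (a.raw : FreeUnitalMagma) := by
  induction a with
  | one => rfl
  | pair e a b iha ihb =>
    simp only [V.eval]
    rw [iha, ihb]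
    rfl

theorem V.raw_length {n : ℕ} (a : V n) : a.raw.length = n := by
  induction a with
  | one => rfl
  | pair e a b iha ihb =>
    exact (congrArg₂ (· + ·) iha ihb).trans e

theorem V.raw_injective {n : ℕ} (a : V n) : ∀ b : V n, a.raw = b.raw → a = b := by
  induction a with
  | one =>
    intro b hb
    cases b with
    | one => rfl
    | pair e b c => exact absurd e (by have := b.pos; have := c.pos; omega)
  | @pair j k n e a b iha ihb =>
    intro c hc
    cases c with
    | one => exact absurd e (by have := a.pos; have := b.pos; omega)
    | @pair j' k' _ e' a' b' =>
      have hc' : a.raw * b.raw = a'.raw * b'.raw := hc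
      have h1 : a.raw = a'.raw ∧ b.raw = b'.raw := by
        injection hc' with h1 h2
        exact ⟨h1, h2⟩
      obtain rfl : j = j' := by rw [← a.raw_length, h1.1, a'.raw_length]
      obtain rfl : k = k' := by omega
      rw [iha a' h1.1, ihb b' h1.2]

theorem V₀.raw_injective {n : ℕ} {a b : V₀ n} (h : a.raw = b.raw) : a = b := by
  cases a with
  | zero =>
    cases b with
    | zero => rfl
    | ofV b => exact absurd b.pos (lt_irrefl _)
  | ofV a =>
    cases b with
    | zero => exact absurd a.pos (lt_irrefl _)
    | ofV b =>
      have h' : (a.raw : FreeUnitalMagma) = b.raw := by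
        rw [← V.raw_coe, ← V.raw_coe]
        exact h
      rw [a.raw_injective b (WithOne.coe_inj.1 h')]

theorem V₀.raw_comp {n m : ℕ} (q : V₀ n) (k : Fin n → ℕ) (h : ∑ i, k i = m)
    (r : ∀ i, V₀ (k i)) : (q.comp k h r).raw = q.eval (fun i => (r i).raw) :=
  q.eval_comp k h r _

/-- The non-symmetric operad `V₀` of unital magmas. -/
def V₀Operad : NSOperad.{0} where
  Op := V₀
  one := .ofV .one
  comp := V₀.comp
  one_comp h q := V₀.raw_injective (V₀.raw_comp _ _ _ _)
  comp_one h q := V₀.raw_injective (V₀.raw_comp _ _ _ _)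
  comp_assoc k h l d hd hp hl q r s := by
    apply V₀.raw_injective
    rw [V₀.raw_comp, V₀.raw_comp, V₀.eval_comp]
    congr 1
    funext i
    rw [V₀.raw_comp]
    congr 1
    funext j
    rw [Equiv.symm_apply_apply]

/-! ### Symmetric operads of sets and the free symmetric operad on a non-symmetric one -/

theorem sum_perm {n m : ℕ} (σ : Equiv.Perm (Fin n)) (k : Fin n → ℕ) (h : ∑ i, k i = m) :
    ∑ i, k (σ.symm i) = m := by
  rw [← h]
  exact Equiv.sum_comp σ.symm k

/-- The block permutation `σ⟨k₀, …, kₙ₋₁⟩`: it moves the `i`-th block, of length `k i`, to the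
`σ i`-th place, keeping the order inside each block. -/
def blockPerm {n m : ℕ} (σ : Equiv.Perm (Fin n)) (k : Fin n → ℕ) (h : ∑ i, k i = m) :
    Equiv.Perm (Fin m) :=
  ((blockEquiv k h).symm.trans (Equiv.sigmaCongrLeft' (β := fun i => Fin (k i)) σ)).trans
    (blockEquiv (fun i => k (σ.symm i)) (sum_perm σ k h))

/-- The block sum `τ₀ ⊕ ⋯ ⊕ τₙ₋₁`. -/
def blockSum {n m : ℕ} (k : Fin n → ℕ) (h : ∑ i, k i = m) (τ : ∀ i, Equiv.Perm (Fin (k i))) :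
    Equiv.Perm (Fin m) :=
  ((blockEquiv k h).symm.trans (Equiv.sigmaCongrRight τ)).trans (blockEquiv k h)

/-- A symmetric operad of sets: a non-symmetric operad with right actions of the symmetric
groups, compatible with composition. -/
structure SymmOperad extends NSOperad.{w} where
  perm : ∀ {n : ℕ}, Equiv.Perm (Fin n) → Op n → Op n
  perm_one : ∀ {n : ℕ} (q : Op n), perm 1 q = q
  perm_mul : ∀ {n : ℕ} (σ τ : Equiv.Perm (Fin n)) (q : Op n),
    perm (σ * τ) q = perm τ (perm σ q)
  comp_perm_left : ∀ {n m : ℕ} (k : Fin n → ℕ) (h : ∑ i, k i = m) (σ : Equiv.Perm (Fin n))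
    (q : Op n) (r : ∀ i, Op (k i)),
    comp k h (perm σ q) r =
      perm (blockPerm σ k h)
        (comp (fun i => k (σ.symm i)) (sum_perm σ k h) q (fun i => r (σ.symm i)))
  comp_perm_right : ∀ {n m : ℕ} (k : Fin n → ℕ) (h : ∑ i, k i = m)
    (q : Op n) (τ : ∀ i, Equiv.Perm (Fin (k i))) (r : ∀ i, Op (k i)),
    comp k h q (fun i => perm (τ i) (r i)) = perm (blockSum k h τ) (comp k h q r)

/-- The permutation `σ⟨k₀, …, kₙ₋₁⟩ ∘ (τ₀ ⊕ ⋯ ⊕ τₙ₋₁)`. -/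
def permComp {n m : ℕ} (k : Fin n → ℕ) (h : ∑ i, k i = m) (σ : Equiv.Perm (Fin n))
    (τ : ∀ i, Equiv.Perm (Fin (k i))) : Equiv.Perm (Fin m) :=
  blockPerm σ k h * blockSum k h τ

theorem sigmaCongrLeft'_mk {n : ℕ} (k : Fin n → ℕ) (σ : Equiv.Perm (Fin n)) (i : Fin n)
    (j : Fin (k i)) :
    Equiv.sigmaCongrLeft' (β := fun i => Fin (k i)) σ ⟨i, j⟩ =
      ⟨σ i, Fin.cast (by simp) j⟩ := by
  apply (Equiv.sigmaCongrLeft' (β := fun i => Fin (k i)) σ).symm.injective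
  rw [Equiv.symm_apply_apply]
  change _ = (⟨σ.symm (σ i), _⟩ : Σ i, Fin (k i))
  ext
  · simp
  · exact (Fin.heq_ext_iff (by simp)).2 (by simp)

theorem permComp_apply {n m : ℕ} (k : Fin n → ℕ) (h : ∑ i, k i = m) (σ : Equiv.Perm (Fin n))
    (τ : ∀ i, Equiv.Perm (Fin (k i))) (i : Fin n) (j : Fin (k i)) :
    permComp k h σ τ (blockEquiv k h ⟨i, j⟩) =
      blockEquiv (fun i => k (σ.symm i)) (sum_perm σ k h)
        ⟨σ i, Fin.cast (by simp) (τ i j)⟩ := by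
  simp only [permComp, blockPerm, blockSum, Equiv.Perm.mul_apply, Equiv.trans_apply,
    Equiv.symm_apply_apply]
  rw [← sigmaCongrLeft'_mk]
  rfl

theorem permComp_symm_apply {n m : ℕ} (k : Fin n → ℕ) (h : ∑ i, k i = m)
    (σ : Equiv.Perm (Fin n)) (τ : ∀ i, Equiv.Perm (Fin (k i))) (i : Fin n)
    (j : Fin (k (σ.symm i))) :
    (permComp k h σ τ).symm
        (blockEquiv (fun i => k (σ.symm i)) (sum_perm σ k h) ⟨i, j⟩) =
      blockEquiv k h ⟨σ.symm i, (τ (σ.symm i)).symm j⟩ := by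
  rw [Equiv.symm_apply_eq, permComp_apply]
  congr 1
  ext
  · simp
  · exact (Fin.heq_ext_iff (by simp)).2 (by simp)

theorem blockEquiv_congr {n m : ℕ} {k k' : Fin n → ℕ} (hk : k = k') (h : ∑ i, k i = m)
    (h' : ∑ i, k' i = m) {i i' : Fin n} (hi : i = i') (j : Fin (k i)) (j' : Fin (k' i'))
    (hj : (j : ℕ) = j') : blockEquiv k h ⟨i, j⟩ = blockEquiv k' h' ⟨i', j'⟩ := by
  subst hk
  subst hi
  rw [Fin.ext hj]

theorem NSOperad.comp_congr (Q : NSOperad.{w}) {X : Type*} {n m : ℕ} (l : X → ℕ)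
    (s : ∀ x, Q.Op (l x)) (q : Q.Op n) {e e' : Fin n → X} (he : e = e')
    (h : ∑ i, l (e i) = m) (h' : ∑ i, l (e' i) = m) :
    Q.comp (fun i => l (e i)) h q (fun i => s (e i)) =
      Q.comp (fun i => l (e' i)) h' q (fun i => s (e' i)) := by
  subst he
  rfl

theorem permComp_symm_split {n m : ℕ} (k : Fin n → ℕ) (h : ∑ i, k i = m)
    (σ : Equiv.Perm (Fin n)) (τ : ∀ i, Equiv.Perm (Fin (k i))) (b : Fin m) :
    (blockEquiv k h).symm ((permComp k h σ τ).symm b) =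
      ⟨σ.symm ((blockEquiv (fun i => k (σ.symm i)) (sum_perm σ k h)).symm b).1,
        (τ _).symm ((blockEquiv (fun i => k (σ.symm i)) (sum_perm σ k h)).symm b).2⟩ := by
  obtain ⟨⟨i, j⟩, rfl⟩ := (blockEquiv (fun i => k (σ.symm i)) (sum_perm σ k h)).surjective b
  rw [permComp_symm_apply, Equiv.symm_apply_apply, Equiv.symm_apply_apply]

theorem blockEquiv_assoc' {n m p : ℕ} (k : Fin n → ℕ) (h : ∑ i, k i = m)
    (l : (Σ i : Fin n, Fin (k i)) → ℕ) (d : Fin n → ℕ)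
    (hd : ∀ i, ∑ j, l ⟨i, j⟩ = d i) (hp : ∑ i, d i = p)
    (l' : Fin m → ℕ) (hl' : ∀ i j, l' (blockEquiv k h ⟨i, j⟩) = l ⟨i, j⟩)
    (hl : ∑ b, l' b = p) (i : Fin n) (j : Fin (k i))
    (t : Fin (l' (blockEquiv k h ⟨i, j⟩))) (t' : Fin (l ⟨i, j⟩)) (ht : (t : ℕ) = t') :
    blockEquiv l' hl ⟨blockEquiv k h ⟨i, j⟩, t⟩ =
      blockEquiv d hp ⟨i, blockEquiv (fun j => l ⟨i, j⟩) (hd _) ⟨j, t'⟩⟩ := by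
  obtain rfl : l' = fun b => l ((blockEquiv k h).symm b) := by
    funext b
    obtain ⟨⟨i, j⟩, rfl⟩ := (blockEquiv k h).surjective b
    rw [hl', Equiv.symm_apply_apply]
  rw [blockEquiv_assoc k h l d hd hp hl]
  have key : ∀ (x : Σ i : Fin n, Fin (k i)) (t : Fin (l x)), x = ⟨i, j⟩ → (t : ℕ) = t' →
      blockEquiv d hp ⟨x.1, blockEquiv (fun j => l ⟨x.1, j⟩) (hd _) ⟨x.2, t⟩⟩ =
      blockEquiv d hp ⟨i, blockEquiv (fun j => l ⟨i, j⟩) (hd _) ⟨j, t'⟩⟩ := by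
    rintro x t rfl ht
    rw [Fin.ext ht]
  exact key _ t (Equiv.symm_apply_apply _ _) ht

theorem perm_val_congr {X : Type*} (l : X → ℕ) (ρ : ∀ x, Equiv.Perm (Fin (l x))) {y x : X}
    (hyx : y = x) (t' : Fin (l y)) (t : Fin (l x)) (ht : (t' : ℕ) = t) :
    ((ρ y t' : Fin (l y)) : ℕ) = (ρ x t : Fin (l x)) := by
  subst hyx
  rw [Fin.ext ht]

theorem blockSum_apply {n m : ℕ} (k : Fin n → ℕ) (h : ∑ i, k i = m)
    (τ : ∀ i, Equiv.Perm (Fin (k i))) (i : Fin n) (j : Fin (k i)) :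
    blockSum k h τ (blockEquiv k h ⟨i, j⟩) = blockEquiv k h ⟨i, τ i j⟩ := by
  simp [blockSum]

theorem permComp_assoc {n m p : ℕ} (k : Fin n → ℕ) (h : ∑ i, k i = m)
    (l : (Σ i : Fin n, Fin (k i)) → ℕ) (d : Fin n → ℕ)
    (hd : ∀ i, ∑ j, l ⟨i, j⟩ = d i) (hp : ∑ i, d i = p)
    (hl : ∑ b, l ((blockEquiv k h).symm b) = p)
    (σ : Equiv.Perm (Fin n)) (τ : ∀ i, Equiv.Perm (Fin (k i)))
    (ρ : ∀ x, Equiv.Perm (Fin (l x))) :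
    permComp (fun b => l ((blockEquiv k h).symm b)) hl (permComp k h σ τ)
        (fun b => ρ ((blockEquiv k h).symm b)) =
      permComp d hp σ (fun i => permComp (fun j => l ⟨i, j⟩) (hd i) (τ i)
        (fun j => ρ ⟨i, j⟩)) := by
  apply Equiv.symm_bijective.injective
  refine Equiv.ext fun c => ?_
  obtain ⟨⟨i, c'⟩, rfl⟩ :=
    (blockEquiv (fun i => d (σ.symm i)) (sum_perm σ d hp)).surjective c
  obtain ⟨⟨j, t⟩, rfl⟩ := (blockEquiv (fun j => l ⟨σ.symm i, (τ (σ.symm i)).symm j⟩)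
    (sum_perm (τ (σ.symm i)) (fun j => l ⟨σ.symm i, j⟩) (hd _))).surjective c'
  rw [permComp_symm_apply, permComp_symm_apply]
  have hsplit := permComp_symm_split k h σ τ
  have hij : (blockEquiv k h).symm ((permComp k h σ τ).symm
      (blockEquiv (fun i => k (σ.symm i)) (sum_perm σ k h) ⟨i, j⟩)) =
      ⟨σ.symm i, (τ (σ.symm i)).symm j⟩ := by
    rw [permComp_symm_apply, Equiv.symm_apply_apply]
  have hc := blockEquiv_assoc' (fun i => k (σ.symm i)) (sum_perm σ k h)
    (fun x => l ⟨σ.symm x.1, (τ (σ.symm x.1)).symm x.2⟩) (fun i => d (σ.symm i))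
    (fun i => sum_perm (τ (σ.symm i)) (fun j => l ⟨σ.symm i, j⟩) (hd _)) (sum_perm σ d hp)
    (fun b => l ((blockEquiv k h).symm ((permComp k h σ τ).symm b)))
    (fun i j => by rw [permComp_symm_apply, Equiv.symm_apply_apply])
    (sum_perm (permComp k h σ τ) (fun b => l ((blockEquiv k h).symm b)) hl) i j
    (Fin.cast (by rw [hij]) t) t rfl
  rw [← hc, permComp_symm_apply]
  refine Eq.trans ?_ (blockEquiv_assoc' k h l d hd hp _
    (fun i j => congrArg l (Equiv.symm_apply_apply _ _)) hl (σ.symm i) ((τ (σ.symm i)).symm j)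
    (Fin.cast (by rw [Equiv.symm_apply_apply]) ((ρ _).symm t)) ((ρ _).symm t) rfl)
  refine blockEquiv_congr rfl _ _ (permComp_symm_apply k h σ τ i j) _ _ ?_
  rw [Fin.val_cast]
  exact perm_val_congr l (fun x => (ρ x).symm) hij _ _ rfl

theorem blockPerm_eq {n m : ℕ} (k : Fin n → ℕ) (h : ∑ i, k i = m) (σ : Equiv.Perm (Fin n)) :
    permComp k h σ (fun _ => 1) = blockPerm σ k h := by
  have : blockSum k h (fun _ => 1) = 1 := by
    ext x
    simp [blockSum]
  rw [permComp, this, mul_one]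

theorem blockPerm_apply {n m : ℕ} (k : Fin n → ℕ) (h : ∑ i, k i = m) (σ : Equiv.Perm (Fin n))
    (i : Fin n) (j : Fin (k i)) :
    blockPerm σ k h (blockEquiv k h ⟨i, j⟩) =
      blockEquiv (fun i => k (σ.symm i)) (sum_perm σ k h) ⟨σ i, Fin.cast (by simp) j⟩ := by
  rw [← blockPerm_eq, permComp_apply]
  rfl

theorem blockPerm_mul_blockSum {n m : ℕ} (k : Fin n → ℕ) (h : ∑ i, k i = m)
    (σ : Equiv.Perm (Fin n)) (τ : ∀ i, Equiv.Perm (Fin (k i))) :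
    blockPerm σ k h * blockSum k h τ =
      blockSum (fun i => k (σ.symm i)) (sum_perm σ k h) (fun i => τ (σ.symm i)) *
        blockPerm σ k h := by
  refine Equiv.ext fun c => ?_
  obtain ⟨⟨i, j⟩, rfl⟩ := (blockEquiv k h).surjective c
  rw [Equiv.Perm.mul_apply, Equiv.Perm.mul_apply, blockSum_apply, blockPerm_apply,
    blockPerm_apply, blockSum_apply]
  refine blockEquiv_congr rfl _ _ rfl _ _ ?_
  rw [Fin.val_cast]
  exact (perm_val_congr k τ (σ.symm_apply_apply i) _ _ rfl).symm

theorem permComp_one_one {m : ℕ} (h : ∑ _i : Fin 1, m = m) (τ : Equiv.Perm (Fin m)) :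
    permComp (fun _ : Fin 1 => m) h 1 (fun _ => τ) = τ := by
  have hb : ∀ (i : Fin 1) (j : Fin m), blockEquiv (fun _ : Fin 1 => m) h ⟨i, j⟩ = j := by
    intro i j
    obtain rfl : i = 0 := Subsingleton.elim _ _
    ext
    rw [blockEquiv_val]
    simp
  refine Equiv.ext fun c => ?_
  obtain ⟨⟨i, j⟩, rfl⟩ := (blockEquiv (fun _ : Fin 1 => m) h).surjective c
  exact (permComp_apply _ h 1 (fun _ => τ) i j).trans
    ((hb _ _).trans (congrArg τ (hb i j).symm))

theorem permComp_one {n : ℕ} (h : ∑ _i : Fin n, 1 = n) (σ : Equiv.Perm (Fin n)) :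
    permComp (fun _ : Fin n => 1) h σ (fun _ => 1) = σ := by
  have hb : ∀ (i : Fin n) (j : Fin 1), blockEquiv (fun _ : Fin n => 1) h ⟨i, j⟩ = i := by
    intro i j
    ext
    rw [blockEquiv_val]
    simp
  refine Equiv.ext fun c => ?_
  obtain ⟨⟨i, j⟩, rfl⟩ := (blockEquiv (fun _ : Fin n => 1) h).surjective c
  exact (permComp_apply _ h σ (fun _ => 1) i j).trans
    ((hb _ _).trans (congrArg σ (hb i j).symm))

theorem blockPerm_mul {n m : ℕ} (k : Fin n → ℕ) (h : ∑ i, k i = m)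
    (ρ σ : Equiv.Perm (Fin n)) :
    blockPerm (ρ * σ) k h =
      blockPerm ρ (fun i => k (σ.symm i)) (sum_perm σ k h) * blockPerm σ k h := by
  refine Equiv.ext fun c => ?_
  obtain ⟨⟨i, j⟩, rfl⟩ := (blockEquiv k h).surjective c
  rw [← blockPerm_eq, ← blockPerm_eq, ← blockPerm_eq, Equiv.Perm.mul_apply, permComp_apply,
    permComp_apply, permComp_apply]
  rfl

/-- The free symmetric operad `LQ` on a non-symmetric operad `Q`: `LQ(n) = Q(n) × Σₙ`, on which
`Σₙ` acts by right multiplication, with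
`Γ((q, σ); (r₁, τ₁), …) = (Γ(q; r_{σ⁻¹1}, …), σ⟨k₁, …⟩ ∘ (τ₁ ⊕ ⋯))`. -/
def freeSymm (Q : NSOperad.{w}) : SymmOperad.{w} where
  Op n := Q.Op n × Equiv.Perm (Fin n)
  one := (Q.one, 1)
  comp k h q r :=
    (Q.comp (fun i => k (q.2.symm i)) (sum_perm q.2 k h) q.1 (fun i => (r (q.2.symm i)).1),
      blockPerm q.2 k h * blockSum k h (fun i => (r i).2))
  perm σ q := (q.1, q.2 * σ)
  one_comp h q := Prod.ext (Q.one_comp h q.1) (permComp_one_one h q.2)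
  comp_one h q := Prod.ext (Q.comp_one h q.1) (permComp_one h q.2)
  comp_assoc k h l d hd hp hl q r s := by
    refine Prod.ext ?_ ?_
    · have e := permComp_symm_split k h q.2 (fun i => (r i).2)
      have := Q.comp_congr l (fun x => (s x).1)
        (Q.comp (fun i => k (q.2.symm i)) (sum_perm q.2 k h) q.1 (fun i => (r (q.2.symm i)).1))
        (funext e)
        (sum_perm (permComp k h q.2 (fun i => (r i).2))
          (fun b => l ((blockEquiv k h).symm b)) hl)
        ((Finset.sum_congr rfl fun b _ => congrArg l (e b).symm).trans
          (sum_perm (permComp k h q.2 (fun i => (r i).2))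
            (fun b => l ((blockEquiv k h).symm b)) hl))
      refine this.trans ?_
      exact Q.comp_assoc (fun i => k (q.2.symm i)) (sum_perm q.2 k h)
        (fun x => l ⟨q.2.symm x.1, ((r (q.2.symm x.1)).2).symm x.2⟩) (fun i => d (q.2.symm i))
        (fun i => sum_perm (r (q.2.symm i)).2 (fun j => l ⟨q.2.symm i, j⟩) (hd _))
        (sum_perm q.2 d hp) _ q.1 (fun i => (r (q.2.symm i)).1)
        (fun x => (s ⟨q.2.symm x.1, ((r (q.2.symm x.1)).2).symm x.2⟩).1)
    · exact permComp_assoc k h l d hd hp hl q.2 (fun i => (r i).2) (fun x => (s x).2)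
  perm_one q := by simp
  perm_mul σ τ q := by simp [mul_assoc]
  comp_perm_left k h σ q r := by
    refine Prod.ext rfl ?_
    dsimp only
    rw [blockPerm_mul, mul_assoc, blockPerm_mul_blockSum, mul_assoc]
  comp_perm_right k h q τ r := by
    refine Prod.ext rfl ?_
    have hs : blockSum k h (fun i => (r i).2 * τ i) =
        blockSum k h (fun i => (r i).2) * blockSum k h τ := by
      ext c
      simp [blockSum]
    dsimp only
    rw [hs, mul_assoc]

/-! ### Categorical operads and their algebras -/

/-- A categorical operad: a symmetric operad in categories. The axioms are those of a symmetric
operad of sets, read as equalities of functors. -/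
structure CatOperad where
  Op : ℕ → Type w
  [cat : ∀ n, Category.{t} (Op n)]
  one : Op 1
  comp : ∀ {n m : ℕ} (k : Fin n → ℕ), ∑ i, k i = m → (Op n × (∀ i, Op (k i)) ⥤ Op m)
  perm : ∀ {n : ℕ}, Equiv.Perm (Fin n) → (Op n ⥤ Op n)
  one_comp : ∀ {m : ℕ} (h : ∑ _i : Fin 1, m = m),
    Functor.prod' ((Functor.const (Op m)).obj one) (Functor.pi' fun _ : Fin 1 => 𝟭 (Op m)) ⋙
      comp (fun _ => m) h = 𝟭 (Op m)
  comp_one : ∀ {n : ℕ} (h : ∑ _i : Fin n, 1 = n),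
    Functor.prod' (𝟭 (Op n)) (Functor.pi' fun _ : Fin n => (Functor.const (Op n)).obj one) ⋙
      comp (fun _ => 1) h = 𝟭 (Op n)
  comp_assoc : ∀ {n m p : ℕ} (k : Fin n → ℕ) (h : ∑ i, k i = m)
    (l : (Σ i : Fin n, Fin (k i)) → ℕ) (d : Fin n → ℕ)
    (hd : ∀ i, ∑ j, l ⟨i, j⟩ = d i) (hp : ∑ i, d i = p)
    (hl : ∑ b, l ((blockEquiv k h).symm b) = p),
    (comp k h).prod (Pi.comap (fun x => Op (l x)) (blockEquiv k h).symm) ⋙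
        comp (fun b => l ((blockEquiv k h).symm b)) hl =
      Functor.prod' (CategoryTheory.Prod.fst _ _ ⋙ CategoryTheory.Prod.fst _ _)
        (Functor.pi' fun i =>
          Functor.prod' (CategoryTheory.Prod.fst _ _ ⋙ CategoryTheory.Prod.snd _ _ ⋙ Pi.eval _ i)
            (CategoryTheory.Prod.snd _ _ ⋙ Pi.comap (fun x => Op (l x)) (fun j : Fin (k i) => ⟨i, j⟩)) ⋙
          comp (fun j => l ⟨i, j⟩) (hd i)) ⋙
      comp d hp
  perm_one : ∀ n : ℕ, perm (1 : Equiv.Perm (Fin n)) = 𝟭 (Op n)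
  perm_mul : ∀ {n : ℕ} (σ τ : Equiv.Perm (Fin n)), perm (σ * τ) = perm σ ⋙ perm τ
  comp_perm_left : ∀ {n m : ℕ} (k : Fin n → ℕ) (h : ∑ i, k i = m) (σ : Equiv.Perm (Fin n)),
    (perm σ).prod (𝟭 (∀ i, Op (k i))) ⋙ comp k h =
      (𝟭 (Op n)).prod (Pi.comap (fun i => Op (k i)) σ.symm) ⋙
        comp (fun i => k (σ.symm i)) (sum_perm σ k h) ⋙ perm (blockPerm σ k h)
  comp_perm_right : ∀ {n m : ℕ} (k : Fin n → ℕ) (h : ∑ i, k i = m)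
    (τ : ∀ i, Equiv.Perm (Fin (k i))),
    (𝟭 (Op n)).prod (Functor.pi fun i => perm (τ i)) ⋙ comp k h =
      comp k h ⋙ perm (blockSum k h τ)

attribute [instance] CatOperad.cat

theorem codiscrete_functor_ext {A : Type*} [Category A] {B : Type*} {F G : A ⥤ Codiscrete B}
    (h : ∀ a, (F.obj a).as = (G.obj a).as) : F = G :=
  CategoryTheory.Functor.ext (fun a => Codiscrete.ext (h a)) (fun _ _ _ => Subsingleton.elim _ _)

/-- The functor `E` from symmetric operads of sets to categorical operads: `E X`, for a set `X`,
is the category with set of objects `X` and exactly one morphism between any two objects. -/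
def codiscreteOperad (P : SymmOperad.{w}) : CatOperad.{w, 0} where
  Op n := Codiscrete (P.Op n)
  one := ⟨P.one⟩
  comp k h := Codiscrete.functor fun x => P.comp k h x.1.as (fun i => (x.2 i).as)
  perm σ := Codiscrete.functorOfFun (P.perm σ)
  one_comp h := codiscrete_functor_ext fun q => P.one_comp h q.as
  comp_one h := codiscrete_functor_ext fun q => P.comp_one h q.as
  comp_assoc k h l d hd hp hl := codiscrete_functor_ext fun x =>
    P.comp_assoc k h l d hd hp hl x.1.1.as (fun i => (x.1.2 i).as) (fun y => (x.2 y).as)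
  perm_one _ := codiscrete_functor_ext fun q => P.perm_one q.as
  perm_mul σ τ := codiscrete_functor_ext fun q => P.perm_mul σ τ q.as
  comp_perm_left k h σ := codiscrete_functor_ext fun x =>
    P.comp_perm_left k h σ x.1.as (fun i => (x.2 i).as)
  comp_perm_right k h τ := codiscrete_functor_ext fun x =>
    P.comp_perm_right k h x.1.as τ (fun i => (x.2 i).as)

/-- The categorical operad `ELV₀`. -/
def ELV₀ : CatOperad.{0, 0} := codiscreteOperad (freeSymm V₀Operad)

/-- An algebra structure over a categorical operad on a category `C`: action functors
`O(n) × Cⁿ ⥤ C` compatible with the unit, the composition and the symmetric group actions. -/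
@[ext]
structure CatOperad.Algebra (O : CatOperad.{w, t}) (C : Type*) [Category C] where
  act : ∀ n : ℕ, O.Op n × (Fin n → C) ⥤ C
  act_one : Functor.prod' ((Functor.const C).obj O.one) (Functor.pi' fun _ : Fin 1 => 𝟭 C) ⋙
    act 1 = 𝟭 C
  act_comp : ∀ {n m : ℕ} (k : Fin n → ℕ) (h : ∑ i, k i = m),
    (O.comp k h).prod (𝟭 (Fin m → C)) ⋙ act m =
      Functor.prod' (CategoryTheory.Prod.fst _ _ ⋙ CategoryTheory.Prod.fst _ _)
        (Functor.pi' fun i =>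
          Functor.prod' (CategoryTheory.Prod.fst _ _ ⋙ CategoryTheory.Prod.snd _ _ ⋙ Pi.eval _ i)
            (CategoryTheory.Prod.snd _ _ ⋙ Pi.comap (fun _ => C) (fun j : Fin (k i) => blockEquiv k h ⟨i, j⟩)) ⋙
          act (k i)) ⋙
      act n
  act_perm : ∀ {n : ℕ} (σ : Equiv.Perm (Fin n)),
    (O.perm σ).prod (𝟭 (Fin n → C)) ⋙ act n =
      (𝟭 (O.Op n)).prod (Pi.comap (fun _ => C) σ.symm) ⋙ act n

/-- A functor is a map of `O`-algebras if it commutes strictly with the actions. -/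
def CatOperad.Algebra.IsMap {O : CatOperad.{w, t}} {C D : Type*} [Category C]
    [Category D] (A : O.Algebra C) (B : O.Algebra D) (F : C ⥤ D) : Prop :=
  ∀ n : ℕ, A.act n ⋙ F = (𝟭 (O.Op n)).prod (Functor.pi fun _ : Fin n => F) ⋙ B.act n

/-- A category with an algebra structure over `O`. -/
structure AlgebraCat (O : CatOperad.{w, t}) where
  carrier : Type u
  [cat : Category.{v} carrier]
  str : O.Algebra carrier

attribute [instance] AlgebraCat.cat

/-- A map of `O`-algebras. -/
@[ext]
structure AlgebraCat.Hom {O : CatOperad.{w, t}} (X Y : AlgebraCat.{w, t, v, u} O) where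
  functor : X.carrier ⥤ Y.carrier
  isMap : X.str.IsMap Y.str functor

instance (O : CatOperad.{w, t}) : Category (AlgebraCat.{w, t, v, u} O) where
  Hom := AlgebraCat.Hom
  id X := ⟨𝟭 _, fun _ => rfl⟩
  comp f g := ⟨f.functor ⋙ g.functor, fun n => by
    rw [← Functor.assoc, f.isMap n, Functor.assoc, g.isMap n]
    rfl⟩

/-- The functor sending an `O`-algebra to its underlying category. -/
def AlgebraCat.forget (O : CatOperad.{w, t}) : AlgebraCat.{w, t, v, u} O ⥤ Cat.{v, u} where
  obj X := Cat.of X.carrier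
  map f := f.functor.toCatHom

/-! ### Strictly unital symmetric monoidal categories -/

/-- A monoidal category is strictly unital if `𝟙 ⊗ X = X = X ⊗ 𝟙` and the unit isomorphisms are
identities. -/
class IsStrictlyUnital (C : Type u) [Category.{v} C] [MonoidalCategory C] : Prop where
  unit_tensor : ∀ X : C, 𝟙_ C ⊗ X = X
  tensor_unit : ∀ X : C, X ⊗ 𝟙_ C = X
  leftUnitor_hom : ∀ X : C, (λ_ X).hom = eqToHom (unit_tensor X)
  rightUnitor_hom : ∀ X : C, (ρ_ X).hom = eqToHom (tensor_unit X)

/-- A strictly unital symmetric monoidal structure on a category. -/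
structure SUSymmMonoidal (C : Type u) [Category.{v} C] where
  [monoidal : MonoidalCategory C]
  [symmetric : SymmetricCategory C]
  [strictlyUnital : IsStrictlyUnital C]

/-- A functor between symmetric monoidal categories is a strict map if it preserves the unit
object, the tensor product and all the structure isomorphisms on the nose. -/
structure IsStrictMap {C D : Type*} [Category C] [Category D]
    [MonoidalCategory C] [SymmetricCategory C] [MonoidalCategory D] [SymmetricCategory D]
    (F : C ⥤ D) : Prop where
  map_unit : F.obj (𝟙_ C) = 𝟙_ D
  map_tensor : ∀ X Y : C, F.obj (X ⊗ Y) = F.obj X ⊗ F.obj Y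
  map_tensorHom : ∀ {X X' Y Y' : C} (f : X ⟶ X') (g : Y ⟶ Y'),
    F.map (f ⊗ₘ g) =
      eqToHom (map_tensor X Y) ≫ (F.map f ⊗ₘ F.map g) ≫ eqToHom (map_tensor X' Y').symm
  map_associator : ∀ X Y Z : C,
    F.map (α_ X Y Z).hom =
      eqToHom (by rw [map_tensor, map_tensor]) ≫ (α_ (F.obj X) (F.obj Y) (F.obj Z)).hom ≫
        eqToHom (by rw [map_tensor, map_tensor])
  map_leftUnitor : ∀ X : C,
    F.map (λ_ X).hom = eqToHom (by rw [map_tensor, map_unit]) ≫ (λ_ (F.obj X)).hom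
  map_rightUnitor : ∀ X : C,
    F.map (ρ_ X).hom = eqToHom (by rw [map_tensor, map_unit]) ≫ (ρ_ (F.obj X)).hom
  map_braiding : ∀ X Y : C,
    F.map (β_ X Y).hom =
      eqToHom (map_tensor X Y) ≫ (β_ (F.obj X) (F.obj Y)).hom ≫ eqToHom (map_tensor Y X).symm

/-- A strictly unital symmetric monoidal category. -/
structure SUSymmMonCat where
  carrier : Type u
  [cat : Category.{v} carrier]
  str : SUSymmMonoidal carrier

attribute [instance] SUSymmMonCat.cat

instance (X : SUSymmMonCat.{v, u}) : MonoidalCategory X.carrier := X.str.monoidal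
instance (X : SUSymmMonCat.{v, u}) : SymmetricCategory X.carrier := X.str.symmetric
instance (X : SUSymmMonCat.{v, u}) : IsStrictlyUnital X.carrier := X.str.strictlyUnital

/-- A strict map of strictly unital symmetric monoidal categories. -/
@[ext]
structure SUSymmMonCat.Hom (X Y : SUSymmMonCat.{v, u}) where
  functor : X.carrier ⥤ Y.carrier
  isStrict : IsStrictMap functor

theorem IsStrictMap.id {C : Type*} [Category C] [MonoidalCategory C] [SymmetricCategory C] :
    IsStrictMap (𝟭 C) where
  map_unit := rfl
  map_tensor _ _ := rfl
  map_tensorHom _ _ := by simp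
  map_associator _ _ _ := by simp
  map_leftUnitor _ := by simp
  map_rightUnitor _ := by simp
  map_braiding _ _ := by simp

theorem eqToHom_tensorHom {C : Type*} [Category C] [MonoidalCategory C] {X X' Y Y' : C}
    (h : X = X') (h' : Y = Y') :
    (eqToHom h ⊗ₘ eqToHom h') = eqToHom (by rw [h, h']) := by
  subst h
  subst h'
  simp

theorem IsStrictMap.comp {C D E : Type*} [Category C] [Category D] [Category E]
    [MonoidalCategory C] [SymmetricCategory C] [MonoidalCategory D] [SymmetricCategory D]
    [MonoidalCategory E] [SymmetricCategory E] {F : C ⥤ D} {G : D ⥤ E}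
    (hF : IsStrictMap F) (hG : IsStrictMap G) : IsStrictMap (F ⋙ G) where
  map_unit := by
    rw [Functor.comp_obj, hF.map_unit, hG.map_unit]
  map_tensor X Y := by
    simp only [Functor.comp_obj]
    rw [hF.map_tensor, hG.map_tensor]
  map_tensorHom f g := by
    simp [hF.map_tensorHom, hG.map_tensorHom, eqToHom_map]
  map_associator X Y Z := by
    simp [hF.map_associator, hG.map_associator, eqToHom_map]
  map_leftUnitor X := by
    simp [hF.map_leftUnitor, hG.map_leftUnitor, eqToHom_map]
  map_rightUnitor X := by
    simp [hF.map_rightUnitor, hG.map_rightUnitor, eqToHom_map]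
  map_braiding X Y := by
    simp [hF.map_braiding, hG.map_braiding, eqToHom_map]

instance : Category SUSymmMonCat.{v, u} where
  Hom := SUSymmMonCat.Hom
  id X := ⟨𝟭 _, IsStrictMap.id⟩
  comp f g := ⟨f.functor ⋙ g.functor, f.isStrict.comp g.isStrict⟩

/-- The functor sending a strictly unital symmetric monoidal category to its underlying
category. -/
def SUSymmMonCat.forget : SUSymmMonCat.{v, u} ⥤ Cat.{v, u} where
  obj X := Cat.of X.carrier
  map f := f.functor.toCatHom

/-! ### The symmetric monoidal structure given by an algebra -/

/-- `0 ∈ V₀(0)`, as an object of `ELV₀(0)`. -/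
def opZero : ELV₀.Op 0 := ⟨(V₀.zero, 1)⟩

/-- `(1, 1) ∈ V₀(2)` with the identity permutation, as an object of `ELV₀(2)`. -/
def opMul : ELV₀.Op 2 := ⟨(V₀.ofV (.pair rfl .one .one), 1)⟩

/-- `(1, 1) ∈ V₀(2)` with the transposition, as an object of `ELV₀(2)`. -/
def opMulSwap : ELV₀.Op 2 := ⟨(V₀.ofV (.pair rfl .one .one), Equiv.swap 0 1)⟩

/-- `((1, 1), 1) ∈ V₀(3)` with the identity permutation, as an object of `ELV₀(3)`. -/
def opLeft : ELV₀.Op 3 := ⟨(V₀.ofV (.pair rfl (.pair rfl .one .one) .one), 1)⟩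

/-- `(1, (1, 1)) ∈ V₀(3)` with the identity permutation, as an object of `ELV₀(3)`. -/
def opRight : ELV₀.Op 3 := ⟨(V₀.ofV (.pair rfl .one (.pair rfl .one .one)), 1)⟩

/-- The unique isomorphism `((1, 1), 1) ≅ (1, (1, 1))` in `ELV₀(3)`. -/
def opAssoc : opLeft ≅ opRight := Codiscrete.iso _ _

/-- The unique isomorphism `((1, 1), id) ≅ ((1, 1), swap)` in `ELV₀(2)`. -/
def opBraid : opMul ≅ opMulSwap := Codiscrete.iso _ _

/-- The morphism of `Cⁿ`, for `n = 2`, with the two given components. -/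
def homPair {C : Type u} [Category.{v} C] {X X' Y Y' : C} (f : X ⟶ X') (g : Y ⟶ Y') :
    (![X, Y] : Fin 2 → C) ⟶ ![X', Y'] :=
  fun i => match i with
    | 0 => f
    | 1 => g

/-- The symmetric monoidal structure `S` on `C` is the one given by the `ELV₀`-algebra structure
`A`: its unit is the action of `0`, its product the action of `(1, 1)`, and its associativity and
commutativity isomorphisms are the actions of the unique isomorphisms
`((1, 1), 1) ≅ (1, (1, 1))` and `((1, 1), id) ≅ ((1, 1), swap)`. -/
structure IsInducedBy {C : Type u} [Category.{v} C] [MonoidalCategory C] [SymmetricCategory C]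
    (A : ELV₀.Algebra C) : Prop where
  unit_eq : 𝟙_ C = (A.act 0).obj (opZero, ![])
  tensor_eq : ∀ X Y : C, X ⊗ Y = (A.act 2).obj (opMul, ![X, Y])
  tensorHom_eq : ∀ {X X' Y Y' : C} (f : X ⟶ X') (g : Y ⟶ Y'),
    (f ⊗ₘ g) = eqToHom (tensor_eq X Y) ≫
      (A.act 2).map (X := (opMul, ![X, Y])) (Y := (opMul, ![X', Y'])) (CategoryTheory.Prod.mkHom (𝟙 opMul) (homPair f g)) ≫
      eqToHom (tensor_eq X' Y').symm
  associator_eq : ∀ X Y Z : C,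
    ∃ (h : (X ⊗ Y) ⊗ Z = (A.act 3).obj (opLeft, ![X, Y, Z]))
      (h' : (A.act 3).obj (opRight, ![X, Y, Z]) = X ⊗ (Y ⊗ Z)),
      (α_ X Y Z).hom = eqToHom h ≫
        (A.act 3).map (X := (opLeft, ![X, Y, Z])) (Y := (opRight, ![X, Y, Z]))
          (CategoryTheory.Prod.mkHom opAssoc.hom (𝟙 _)) ≫ eqToHom h'
  braiding_eq : ∀ X Y : C,
    ∃ (h : X ⊗ Y = (A.act 2).obj (opMul, ![X, Y]))
      (h' : (A.act 2).obj (opMulSwap, ![X, Y]) = Y ⊗ X),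
      (β_ X Y).hom = eqToHom h ≫
        (A.act 2).map (X := (opMul, ![X, Y])) (Y := (opMulSwap, ![X, Y]))
          (CategoryTheory.Prod.mkHom opBraid.hom (𝟙 _)) ≫ eqToHom h'

/-- `IsInducedBy` for bundled structures. -/
def SUSymmMonoidal.IsInducedBy {C : Type u} [Category.{v} C] (S : SUSymmMonoidal C)
    (A : ELV₀.Algebra C) : Prop :=
  letI := S.monoidal
  letI := S.symmetric
  OperadSMC.IsInducedBy A

end OperadSMC

/-! An operation `(β, σ)` of `LV₀ n` is a word in `n` distinct letters, bracketed by `β` and ordered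
by `σ⁻¹`; operadic composition is substitution of words, and strict units are deleted. Since `ELV₀`
has exactly one isomorphism between any two such words, the theorem is a form of coherence for
symmetric monoidal categories.

From structures to algebras, an operation acts by evaluating its word, and the isomorphism between
two operations acts by the value of some formal composite of structure isomorphisms (`Word.Path`).
By `Word.Path.eval_eq` the choice does not matter when letters are not repeated. That coherence
theorem is proved without rewriting systems. If at most one letter is not a unit, every word
contracts by unitors in one way only, and structure isomorphisms respect contractions. In general, a
family `x` is isomorphic to `y ⊗ z`, where `y` has one letter of `x` replaced by the unit and `z`
has only that letter. Because `⊗` is a symmetric monoidal functor, the value of a path on `y ⊗ z` is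
determined by its values on `y` and on `z`, and induction on the number of letters that are not
units concludes. When units are strict, words may also be replaced by others with the same image in
the free unital magma.

From algebras to structures, `CatOperad.Algebra.Realizes` says that an arrow is the action of an
isomorphism between operations that present two given words. Realized arrows are closed under
composition and substitution, and by `Realizes.unique` two arrows realizing the same pair of words
are equal if the source word has no repeated letter. Hence every axiom follows by checking that its
two sides realize the same pair of words. The same uniqueness shows that an algebra is recovered
from its symmetric monoidal structure; coherence gives the other round trip. Strict maps preserve
values of words and paths, and algebra maps preserve the actions defining the structure, so the two
kinds of maps are the same functors.

Equalities of morphisms whose endpoints agree only propositionally are stated in `Arrow C`, where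
transports disappear. -/

namespace OperadSMC

/-! ### Coherence for symmetric monoidal categories -/

/-- Words in the letters `ι`: iterated binary products of letters and units. -/
inductive Word (ι : Type*)
  | unit : Word ι
  | of (i : ι) : Word ι
  | mul (a b : Word ι) : Word ι

namespace Word

variable {ι : Type*}

instance : Mul (Word ι) := ⟨Word.mul⟩

/-- The letters of a word, in order. -/
def letters : Word ι → List ι
  | unit => []
  | of i => [i]
  | mul a b => a.letters ++ b.letters

/-- The right-normed word with the given letters. -/
def ofList : List ι → Word ι
  | [] => unit
  | i :: l => mul (of i) (ofList l)

/-- Formal composites of the structure isomorphisms of a symmetric monoidal category. -/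
inductive Path : Word ι → Word ι → Type _
  | id (a : Word ι) : Path a a
  | comp {a b c : Word ι} (p : Path a b) (q : Path b c) : Path a c
  | tensor {a b a' b' : Word ι} (p : Path a b) (q : Path a' b') : Path (mul a a') (mul b b')
  | assoc (a b c : Word ι) : Path (mul (mul a b) c) (mul a (mul b c))
  | assocInv (a b c : Word ι) : Path (mul a (mul b c)) (mul (mul a b) c)
  | left (a : Word ι) : Path (mul unit a) a
  | leftInv (a : Word ι) : Path a (mul unit a)
  | right (a : Word ι) : Path (mul a unit) a
  | rightInv (a : Word ι) : Path a (mul a unit)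
  | braid (a b : Word ι) : Path (mul a b) (mul b a)

/-- The reverse of a path. -/
def Path.symm : ∀ {a b : Word ι}, Path a b → Path b a
  | _, _, id a => id a
  | _, _, comp p q => comp q.symm p.symm
  | _, _, tensor p q => tensor p.symm q.symm
  | _, _, assoc a b c => assocInv a b c
  | _, _, assocInv a b c => assoc a b c
  | _, _, left a => leftInv a
  | _, _, leftInv a => left a
  | _, _, right a => rightInv a
  | _, _, rightInv a => right a
  | _, _, braid a b => braid b a

theorem nonempty_path_mul_ofList (l l' : List ι) :
    Nonempty (Path (mul (ofList l) (ofList l')) (ofList (l ++ l'))) := by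
  induction l with
  | nil => exact ⟨.left _⟩
  | cons i l ih =>
    obtain ⟨p⟩ := ih
    exact ⟨(Path.assoc _ _ _).comp ((Path.id _).tensor p)⟩

theorem nonempty_path_ofList (a : Word ι) : Nonempty (Path a (ofList a.letters)) := by
  induction a with
  | unit => exact ⟨.id _⟩
  | of i => exact ⟨.rightInv _⟩
  | mul a b iha ihb =>
    obtain ⟨p⟩ := iha
    obtain ⟨q⟩ := ihb
    obtain ⟨r⟩ := nonempty_path_mul_ofList a.letters b.letters
    exact ⟨(p.tensor q).comp r⟩

/-- Adjacent swaps generate all permutations, and an adjacent swap is a braiding conjugated by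
associators. -/
theorem nonempty_path_of_perm {l l' : List ι} (h : l.Perm l') :
    Nonempty (Path (ofList l) (ofList l')) := by
  induction h with
  | nil => exact ⟨.id _⟩
  | cons i _ ih => exact ih.map fun p => (Path.id _).tensor p
  | swap i j l =>
    exact ⟨(Path.assocInv _ _ _).comp (((Path.braid _ _).tensor (.id _)).comp (.assoc _ _ _))⟩
  | trans _ _ ih ih' =>
    obtain ⟨p⟩ := ih
    obtain ⟨q⟩ := ih'
    exact ⟨p.comp q⟩

/-- Words with the same letters are connected by a formal structure isomorphism. -/
theorem nonempty_path {a b : Word ι} (h : a.letters.Perm b.letters) : Nonempty (Path a b) := by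
  obtain ⟨p⟩ := a.nonempty_path_ofList
  obtain ⟨q⟩ := b.nonempty_path_ofList
  obtain ⟨r⟩ := nonempty_path_of_perm h
  exact ⟨p.comp (r.comp q.symm)⟩

section Eval

variable {C : Type*} [Category C] [MonoidalCategory C]

/-- The value of a word in a monoidal category. -/
@[reducible]
def obj (x : ι → C) : Word ι → C
  | unit => 𝟙_ C
  | of i => x i
  | mul a b => obj x a ⊗ obj x b

/-- The value of a word on a family of morphisms. -/
def map {x y : ι → C} (f : ∀ i, x i ⟶ y i) : ∀ a : Word ι, a.obj x ⟶ a.obj y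
  | unit => 𝟙 _
  | of i => f i
  | mul a b => map f a ⊗ₘ map f b

theorem map_id (x : ι → C) (a : Word ι) : a.map (fun i => 𝟙 (x i)) = 𝟙 _ := by
  induction a with
  | unit => rfl
  | of i => rfl
  | mul a b iha ihb => simp [map, iha, ihb, obj]

theorem map_comp {x y z : ι → C} (f : ∀ i, x i ⟶ y i) (g : ∀ i, y i ⟶ z i) (a : Word ι) :
    a.map (fun i => f i ≫ g i) = a.map f ≫ a.map g := by
  induction a with
  | unit => simp [map, obj]
  | of i => rfl
  | mul a b iha ihb => simp [map, iha, ihb]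

/-! ### Words with at most one letter that is not a unit -/

/-- The object `X` or the unit object. -/
@[reducible]
def objOrUnit (X : C) : Bool → C
  | true => X
  | false => 𝟙_ C

/-- Contractions by unitors of words in which all letters but at most one are units. -/
inductive Contraction (X : C) {x : ι → C} (s : ι → Bool) (e : ∀ i, x i ≅ objOrUnit X (s i)) :
    ∀ (a : Word ι) (b : Bool), (a.obj x ⟶ objOrUnit X b) → Prop
  | unit : Contraction X s e unit false (𝟙 _)
  | of (i : ι) : Contraction X s e (of i) (s i) (e i).hom
  | mul {a a' : Word ι} {f : a.obj x ⟶ 𝟙_ C} {f' : a'.obj x ⟶ 𝟙_ C}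
      (h : Contraction X s e a false f) (h' : Contraction X s e a' false f') :
      Contraction X s e (mul a a') false ((f ⊗ₘ f') ≫ (λ_ _).hom)
  | mulLeft {a a' : Word ι} {f : a.obj x ⟶ X} {f' : a'.obj x ⟶ 𝟙_ C}
      (h : Contraction X s e a true f) (h' : Contraction X s e a' false f') :
      Contraction X s e (mul a a') true ((f ⊗ₘ f') ≫ (ρ_ _).hom)
  | mulRight {a a' : Word ι} {f : a.obj x ⟶ 𝟙_ C} {f' : a'.obj x ⟶ X}
      (h : Contraction X s e a false f) (h' : Contraction X s e a' true f') :
      Contraction X s e (mul a a') true ((f ⊗ₘ f') ≫ (λ_ _).hom)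

namespace Contraction

variable {X : C} {x : ι → C} {s : ι → Bool} {e : ∀ i, x i ≅ objOrUnit X (s i)}

theorem isIso {a : Word ι} {b : Bool} {f : a.obj x ⟶ objOrUnit X b}
    (h : Contraction X s e a b f) : IsIso f := by
  induction h <;> infer_instance

/-- The Booleans of the two factors decide which product rule applies. Leaving `b'` free, at the
price of a heterogeneous equality, lets the induction hypotheses refute mismatched rules. -/
theorem bool_eq {a : Word ι} {b b' : Bool} {f : a.obj x ⟶ objOrUnit X b}
    {f' : a.obj x ⟶ objOrUnit X b'} (h : Contraction X s e a b f)
    (h' : Contraction X s e a b' f') : b = b' ∧ f ≍ f' := by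
  induction h generalizing b' with
  | unit => cases h'; exact ⟨rfl, HEq.rfl⟩
  | of i => cases h'; exact ⟨rfl, HEq.rfl⟩
  | mul _ _ ih ih' =>
    cases h' with
    | mul k k' => rw [eq_of_heq (ih k).2, eq_of_heq (ih' k').2]; exact ⟨rfl, HEq.rfl⟩
    | mulLeft k k' => exact absurd (ih k).1 (by simp)
    | mulRight k k' => exact absurd (ih' k').1 (by simp)
  | mulLeft _ _ ih ih' =>
    cases h' with
    | mul k k' => exact absurd (ih k).1 (by simp)
    | mulLeft k k' => rw [eq_of_heq (ih k).2, eq_of_heq (ih' k').2]; exact ⟨rfl, HEq.rfl⟩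
    | mulRight k k' => exact absurd (ih k).1 (by simp)
  | mulRight _ _ ih ih' =>
    cases h' with
    | mul k k' => exact absurd (ih' k').1 (by simp)
    | mulLeft k k' => exact absurd (ih k).1 (by simp)
    | mulRight k k' => rw [eq_of_heq (ih k).2, eq_of_heq (ih' k').2]; exact ⟨rfl, HEq.rfl⟩

theorem unique {a : Word ι} {b : Bool} {f f' : a.obj x ⟶ objOrUnit X b}
    (h : Contraction X s e a b f) (h' : Contraction X s e a b f') : f = f' :=
  eq_of_heq (h.bool_eq h').2

/-- Contraction gets stuck only at a product both of whose factors contain a marked letter. As at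
most one letter is marked, it would then occur twice. The last clause carries the marked letter
through the induction. -/
theorem exists_of_nodup (a : Word ι) (ha : a.letters.Nodup)
    (hs : ∀ i j, s i = true → s j = true → i = j) :
    ∃ (b : Bool) (f : _), Contraction X s e a b f ∧ (b = true → ∃ i ∈ a.letters, s i = true) := by
  induction a with
  | unit => exact ⟨_, _, .unit, by simp⟩
  | of i => exact ⟨_, _, .of i, fun h => ⟨i, by simp [letters], h⟩⟩
  | mul a a' ih ih' =>
    obtain ⟨h1, h2, h3⟩ := List.nodup_append.1 ha
    obtain ⟨b, f, h, hb⟩ := ih h1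
    obtain ⟨b', f', h', hb'⟩ := ih' h2
    cases b <;> cases b'
    · exact ⟨_, _, h.mul h', by simp⟩
    · refine ⟨_, _, h.mulRight h', fun _ => ?_⟩
      obtain ⟨i, hi, hsi⟩ := hb' rfl
      exact ⟨i, List.mem_append_right _ hi, hsi⟩
    · refine ⟨_, _, h.mulLeft h', fun _ => ?_⟩
      obtain ⟨i, hi, hsi⟩ := hb rfl
      exact ⟨i, List.mem_append_left _ hi, hsi⟩
    · obtain ⟨i, hi, hsi⟩ := hb rfl
      obtain ⟨j, hj, hsj⟩ := hb' rfl
      exact absurd (hs i j hsi hsj) (h3 i hi j hj)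

end Contraction

variable [SymmetricCategory C]

/-- The value of a formal structure isomorphism in a symmetric monoidal category. -/
def Path.eval (x : ι → C) : ∀ {a b : Word ι}, Path a b → (a.obj x ⟶ b.obj x)
  | _, _, id _ => 𝟙 _
  | _, _, comp p q => p.eval x ≫ q.eval x
  | _, _, tensor p q => p.eval x ⊗ₘ q.eval x
  | _, _, assoc _ _ _ => (α_ _ _ _).hom
  | _, _, assocInv _ _ _ => (α_ _ _ _).inv
  | _, _, left _ => (λ_ _).hom
  | _, _, leftInv _ => (λ_ _).inv
  | _, _, right _ => (ρ_ _).hom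
  | _, _, rightInv _ => (ρ_ _).inv
  | _, _, braid _ _ => (β_ _ _).hom

theorem Path.eval_symm_comp (x : ι → C) {a b : Word ι} (p : Path a b) :
    p.symm.eval x ≫ p.eval x = 𝟙 _ := by
  induction p with
  | id => simp [symm, eval]
  | comp p q ihp ihq =>
    simp only [symm, eval, Category.assoc]
    rw [reassoc_of% ihp, ihq]
  | tensor p q ihp ihq => simp [symm, eval, ihp, ihq, obj]
  | _ => simp [symm, eval, obj]

theorem Path.symm_symm {a b : Word ι} (p : Path a b) : p.symm.symm = p := by
  induction p with
  | comp p q ihp ihq => simp [symm, ihp, ihq]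
  | tensor p q ihp ihq => simp [symm, ihp, ihq]
  | _ => rfl

theorem Path.eval_comp_symm (x : ι → C) {a b : Word ι} (p : Path a b) :
    p.eval x ≫ p.symm.eval x = 𝟙 _ := by
  simpa only [symm_symm] using p.symm.eval_symm_comp x

/-- Each generating structure isomorphism is natural. This makes the action functorial and moves
coherence along isomorphisms of letters. -/
theorem Path.naturality {x y : ι → C} (f : ∀ i, x i ⟶ y i) {a b : Word ι} (p : Path a b) :
    a.map f ≫ p.eval y = p.eval x ≫ b.map f := by
  induction p with
  | id => simp [eval]
  | comp p q ihp ihq =>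
    simp only [eval, Category.assoc]
    rw [← ihq, reassoc_of% ihp]
  | tensor p q ihp ihq => simp [eval, map, ihp, ihq]
  | assoc => simp [eval, map]
  | assocInv => simp [eval, map]
  | left => simp [eval, map, id_tensorHom, obj]
  | leftInv => simp [eval, map, id_tensorHom, obj]
  | right => simp [eval, map, tensorHom_id, obj]
  | rightInv => simp [eval, map, tensorHom_id, obj]
  | braid => simp [eval, map]

/-! ### The tensor product as a symmetric monoidal functor -/

theorem tensorμ_braiding (X₁ X₂ Y₁ Y₂ : C) :
    tensorμ X₁ X₂ Y₁ Y₂ ≫ (β_ (X₁ ⊗ Y₁) (X₂ ⊗ Y₂)).hom =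
      ((β_ X₁ X₂).hom ⊗ₘ (β_ Y₁ Y₂).hom) ≫ tensorμ X₂ X₁ Y₂ Y₁ := by
  -- Symmetry is used here: the middle crossing of `tensorμ` is rewritten as the inverse of the
  -- opposite crossing, which the braiding of the products supplies.
  simp [tensorμ, SymmetricCategory.braiding_swap_eq_inv_braiding Y₁ X₂, MonoidalCategory.tensorHom_def]

/-- Interchange of a word of binary products with the product of two words. -/
def interchange (y z : ι → C) : ∀ a : Word ι, a.obj y ⊗ a.obj z ⟶ a.obj (fun i => y i ⊗ z i)
  | unit => (λ_ _).hom
  | of _ => 𝟙 _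
  | mul a b => tensorμ _ _ _ _ ≫ (interchange y z a ⊗ₘ interchange y z b)

instance (y z : ι → C) (a : Word ι) : IsIso (a.interchange y z) := by
  induction a with
  | unit => exact inferInstanceAs (IsIso (λ_ (𝟙_ C)).hom)
  | of i => exact inferInstanceAs (IsIso (𝟙 (y i ⊗ z i)))
  | mul a b _ _ =>
    have : IsIso (tensorμ (a.obj y) (b.obj y) (a.obj z) (b.obj z)) :=
      ⟨tensorδ _ _ _ _, by simp, by simp⟩
    exact inferInstanceAs (IsIso (tensorμ _ _ _ _ ≫ (interchange y z a ⊗ₘ interchange y z b)))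

/-- This expresses that `⊗`, with `tensorμ`, is a symmetric monoidal functor. Consequently, as
`interchange` is invertible, the value of a path on `y ⊗ z` is determined by its values on `y` and
`z`. -/
theorem Path.interchange_naturality (y z : ι → C) {a b : Word ι} (p : Path a b) :
    (p.eval y ⊗ₘ p.eval z) ≫ b.interchange y z =
      a.interchange y z ≫ p.eval (fun i => y i ⊗ z i) := by
  -- A commuting square of isomorphisms can be reversed, so the inverse generators follow from the
  -- direct ones.
  have key : ∀ {a b : Word ι} (p : Path a b),
      ((p.eval y ⊗ₘ p.eval z) ≫ b.interchange y z =
        a.interchange y z ≫ p.eval (fun i => y i ⊗ z i)) →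
      ((p.symm.eval y ⊗ₘ p.symm.eval z) ≫ a.interchange y z =
        b.interchange y z ≫ p.symm.eval (fun i => y i ⊗ z i)) := by
    intro a b p hp
    have : IsIso (p.eval fun i => y i ⊗ z i) := ⟨_, p.eval_comp_symm _, p.eval_symm_comp _⟩
    rw [← cancel_mono (p.eval (fun i => y i ⊗ z i)), Category.assoc, ← hp, Category.assoc,
      p.eval_symm_comp, tensorHom_comp_tensorHom_assoc, p.eval_symm_comp, p.eval_symm_comp]
    simp
  have hα : ∀ a b c : Word ι, ((α_ (a.obj y) (b.obj y) (c.obj y)).hom ⊗ₘ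
      (α_ (a.obj z) (b.obj z) (c.obj z)).hom) ≫ (mul a (mul b c)).interchange y z =
      (mul (mul a b) c).interchange y z ≫ (α_ _ _ _).hom := by
    intro a b c
    have h1 : ∀ {X Y Z X' : C} (f : X ⟶ X') (g : Y ⟶ Z) {W : C} (h : Z ⟶ W),
        (f ⊗ₘ g ≫ h) = X ◁ g ≫ (f ⊗ₘ h) := by intros; simp [← id_tensorHom]
    have h2 : ∀ {X Y Z X' : C} (f : X ⟶ X') (g : Y ⟶ Z) {W : C} (h : Z ⟶ W),
        (g ≫ h ⊗ₘ f) = g ▷ X ≫ (h ⊗ₘ f) := by intros; simp [← tensorHom_id]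
    simp only [interchange, h1, h2, Category.assoc, associator_naturality]
    rw [associator_monoidal_assoc]
  have hl : ∀ a : Word ι, ((λ_ (a.obj y)).hom ⊗ₘ (λ_ (a.obj z)).hom) ≫ a.interchange y z =
      (mul unit a).interchange y z ≫ (λ_ _).hom := by
    intro a
    simp only [interchange]
    rw [leftUnitor_monoidal, Category.assoc, Category.assoc, Category.assoc,
      ← leftUnitor_naturality, MonoidalCategory.tensorHom_def, Category.assoc]
  have hr : ∀ a : Word ι, ((ρ_ (a.obj y)).hom ⊗ₘ (ρ_ (a.obj z)).hom) ≫ a.interchange y z =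
      (mul a unit).interchange y z ≫ (ρ_ _).hom := by
    intro a
    simp only [interchange]
    rw [rightUnitor_monoidal, Category.assoc, Category.assoc, Category.assoc,
      ← rightUnitor_naturality, tensorHom_def', Category.assoc]
  induction p with
  | id => simp [eval]
  | comp p q ihp ihq =>
    simp only [eval]
    rw [← tensorHom_comp_tensorHom, Category.assoc, ihq, reassoc_of% ihp]
  | tensor p q ihp ihq =>
    simp only [eval, interchange]
    rw [tensorμ_natural_assoc, tensorHom_comp_tensorHom, ihp, ihq]
    simp
  | assoc a b c => exact hα a b c
  | assocInv a b c => exact key (.assoc a b c) (hα a b c)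
  | left a => exact hl a
  | leftInv a => exact key (.left a) (hl a)
  | right a => exact hr a
  | rightInv a => exact key (.right a) (hr a)
  | braid a b =>
    simp only [eval, interchange, Category.assoc]
    rw [BraidedCategory.braiding_naturality, reassoc_of% tensorμ_braiding]

namespace Contraction

variable {X : C} {x : ι → C} {s : ι → Bool} {e : ∀ i, x i ≅ objOrUnit X (s i)}

/-- In a contracted word at most one factor differs from the unit, so every generator reduces to a
relation between unitors: the triangle identities for associators, and the compatibility of the
braiding with the unitors for braids. -/
theorem path_comp {a a' : Word ι} (p : Path a a') {b : Bool} {f : a'.obj x ⟶ objOrUnit X b}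
    (h : Contraction X s e a' b f) : Contraction X s e a b (p.eval x ≫ f) := by
  induction p generalizing b with
  | id => simpa [Path.eval] using h
  | comp p q ihp ihq =>
    have := ihp (ihq h)
    simpa only [Path.eval, Category.assoc] using this
  | tensor p q ihp ihq =>
    simp only [Path.eval]
    cases h with
    | mul h h' => simpa using (ihp h).mul (ihq h')
    | mulLeft h h' => simpa using (ihp h).mulLeft (ihq h')
    | mulRight h h' => simpa using (ihp h).mulRight (ihq h')
  | assoc =>
    simp only [Path.eval]
    cases h with
    | mul h h' =>
      cases h' with | mul h' h'' =>
      convert (h.mul h').mul h'' using 1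
      simp [tensorHom_def', unitors_equal]
    | mulLeft h h' =>
      cases h' with | mul h' h'' =>
      convert (h.mulLeft h').mulLeft h'' using 1
      simp [tensorHom_def']
    | mulRight h h' =>
      cases h' with
      | mulLeft h' h'' =>
        convert (h.mulRight h').mulLeft h'' using 1
        simp [tensorHom_def']
      | mulRight h' h'' =>
        convert (h.mul h').mulRight h'' using 1
        simp [tensorHom_def']
  | assocInv =>
    simp only [Path.eval]
    cases h with
    | mul h h'' =>
      cases h with | mul h h' =>
      convert h.mul (h'.mul h'') using 1
      simp [tensorHom_def', unitors_equal]
    | mulLeft h h'' =>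
      cases h with
      | mulLeft h h' =>
        convert h.mulLeft (h'.mul h'') using 1
        simp [tensorHom_def']
      | mulRight h h' =>
        convert h.mulRight (h'.mulLeft h'') using 1
        simp [tensorHom_def']
    | mulRight h h'' =>
      cases h with | mul h h' =>
      convert h.mulRight (h'.mulRight h'') using 1
      simp [tensorHom_def']
  | left =>
    simp only [Path.eval]
    cases b with
    | true => simpa using Contraction.unit.mulRight h
    | false => simpa using Contraction.unit.mul h
  | leftInv =>
    simp only [Path.eval]
    cases h with
    | mul h h' => cases h; simpa
    | mulLeft h h' => cases h
    | mulRight h h' => cases h; simpa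
  | right =>
    simp only [Path.eval]
    cases b with
    | true => simpa using h.mulLeft .unit
    | false => simpa [unitors_equal] using h.mul .unit
  | rightInv =>
    simp only [Path.eval]
    cases h with
    | mul h h' => cases h'; simpa [unitors_equal]
    | mulLeft h h' => cases h'; simpa
    | mulRight h h' => cases h'
  | braid =>
    simp only [Path.eval]
    cases h with
    | mul h h' =>
      have := h'.mul h
      rwa [unitors_equal, ← braiding_leftUnitor,
        BraidedCategory.braiding_naturality_assoc] at this
    | mulLeft h h' =>
      have := h'.mulRight h
      rwa [← braiding_rightUnitor, BraidedCategory.braiding_naturality_assoc] at this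
    | mulRight h h' =>
      have := h'.mulLeft h
      rwa [← braiding_leftUnitor, BraidedCategory.braiding_naturality_assoc] at this

end Contraction

/-- A contraction of the target, composed with either path, is the unique contraction of the source;
being invertible, it can be cancelled. -/
theorem Path.eval_eq_of_contraction {X : C} {x : ι → C} (s : ι → Bool)
    (e : ∀ i, x i ≅ objOrUnit X (s i)) (hs : ∀ i j, s i = true → s j = true → i = j)
    {a b : Word ι} (hb : b.letters.Nodup) (p q : Path a b) : p.eval x = q.eval x := by
  obtain ⟨_, f, h, -⟩ := Contraction.exists_of_nodup (X := X) (e := e) b hb hs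
  have := h.isIso
  rw [← cancel_mono f]
  exact (h.path_comp p).unique (h.path_comp q)

theorem Path.eval_eq_of_iso {x y : ι → C} (e : ∀ i, x i ≅ y i) {a b : Word ι} {p q : Path a b}
    (h : p.eval y = q.eval y) : p.eval x = q.eval x := by
  have hp := p.naturality fun i => (e i).hom
  have hq := q.naturality fun i => (e i).hom
  have : b.map (fun i => (e i).hom) ≫ b.map (fun i => (e i).inv) = 𝟙 _ := by
    rw [← map_comp]
    simp only [Iso.hom_inv_id]
    exact map_id _ _
  rw [h, hq] at hp
  have := congrArg (· ≫ b.map (fun i => (e i).inv)) hp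
  simpa [‹b.map _ ≫ _ = _›] using this.symm

/-- Coherence for symmetric monoidal categories: parallel formal structure isomorphisms
between words without repeated letters have the same value. -/
theorem Path.eval_eq [Finite ι] (x : ι → C) {a b : Word ι} (hb : b.letters.Nodup)
    (p q : Path a b) : p.eval x = q.eval x := by
  classical
  -- The set `S` contains all letters not known to be isomorphic to the unit; the induction removes
  -- them one at a time.
  have key : ∀ (S : Set ι), S.Finite → ∀ x : ι → C, (∀ i, i ∉ S → Nonempty (x i ≅ 𝟙_ C)) →
      p.eval x = q.eval x := by
    intro S hS
    induction S, hS using Set.Finite.induction_on with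
    | empty =>
      intro x hx
      exact eval_eq_of_contraction (X := 𝟙_ C) (fun _ => false)
        (fun i => (hx i (Set.notMem_empty i)).some) (by simp) hb p q
    | @insert j S hj _ ih =>
      intro x hx
      -- The family `x` splits as `y ⊗ z` up to unitors: `y` falls under the induction hypothesis,
      -- and `z` has at most the one nontrivial letter `j`.
      let y : ι → C := fun i => if i = j then 𝟙_ C else x i
      let z : ι → C := fun i => if i = j then x j else 𝟙_ C
      have hy : p.eval y = q.eval y := by
        refine ih y fun i hi => ?_
        by_cases hij : i = j
        · exact ⟨eqToIso (if_pos hij)⟩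
        · obtain ⟨e⟩ := hx i (by simp [hi, hij])
          exact ⟨eqToIso (if_neg hij) ≪≫ e⟩
      have hz : p.eval z = q.eval z := by
        refine eval_eq_of_contraction (X := x j) (fun i => decide (i = j))
          (fun i => eqToIso ?_) (by simp +contextual) hb p q
        by_cases hij : i = j <;> simp [z, hij]
      refine eval_eq_of_iso (y := fun i => y i ⊗ z i) (fun i => ?_) ?_
      · by_cases hij : i = j
        · exact eqToIso (by rw [hij]) ≪≫ (λ_ (x j)).symm ≪≫
            (eqToIso (if_pos hij).symm ⊗ᵢ eqToIso (if_pos hij).symm)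
        · exact (ρ_ (x i)).symm ≪≫ (eqToIso (if_neg hij).symm ⊗ᵢ eqToIso (if_neg hij).symm)
      · rw [← cancel_epi (a.interchange y z), ← interchange_naturality, ← interchange_naturality,
          hy, hz]
  exact key Set.univ Set.finite_univ x fun i hi => absurd (Set.mem_univ i) hi

end Eval
end Word
end OperadSMC

namespace OperadSMC

/-! ### Equality of morphisms up to equality of their endpoints -/

/-- Equality in `Arrow C` includes equality of the endpoints, so it can compare composites through
middle objects that are only propositionally equal. -/
theorem arrow_mk_comp_congr {C : Type*} [Category C] {X Y Z X' Y' Z' : C} {f : X ⟶ Y}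
    {g : Y ⟶ Z} {f' : X' ⟶ Y'} {g' : Y' ⟶ Z'} (hf : Arrow.mk f = Arrow.mk f')
    (hg : Arrow.mk g = Arrow.mk g') : Arrow.mk (f ≫ g) = Arrow.mk (f' ≫ g') := by
  obtain ⟨rfl, rfl, rfl⟩ := (Arrow.mk_eq_mk_iff _ _).1 hf
  obtain ⟨-, rfl, rfl⟩ := (Arrow.mk_eq_mk_iff _ _).1 hg
  simp

theorem arrow_mk_id_congr {C : Type*} [Category C] {X Y : C} (h : X = Y) :
    Arrow.mk (𝟙 X) = Arrow.mk (𝟙 Y) := by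
  rw [h]

/-- A morphism is an identity up to equality of objects. -/
def IsIdentity {C : Type*} [Category C] {X Y : C} (f : X ⟶ Y) : Prop :=
  ∃ h : X = Y, f = eqToHom h

namespace IsIdentity

variable {C : Type*} [Category C]

theorem comp {X Y Z : C} {f : X ⟶ Y} {g : Y ⟶ Z} (hf : IsIdentity f) (hg : IsIdentity g) :
    IsIdentity (f ≫ g) := by
  obtain ⟨rfl, rfl⟩ := hf
  obtain ⟨rfl, rfl⟩ := hg
  exact ⟨rfl, by simp⟩

theorem tensorHom [MonoidalCategory C] {X Y X' Y' : C} {f : X ⟶ Y} {g : X' ⟶ Y'}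
    (hf : IsIdentity f) (hg : IsIdentity g) : IsIdentity (f ⊗ₘ g) := by
  obtain ⟨rfl, rfl⟩ := hf
  obtain ⟨rfl, rfl⟩ := hg
  exact ⟨rfl, by simp⟩

theorem inv {X Y : C} {e : X ≅ Y} (he : IsIdentity e.hom) : IsIdentity e.inv := by
  obtain ⟨rfl, h⟩ := he
  exact ⟨rfl, by rw [← cancel_epi e.hom, e.hom_inv_id, h]; simp⟩

theorem arrow_comp {X Y Z : C} {f : X ⟶ Y} (hf : IsIdentity f) (g : Y ⟶ Z) :
    Arrow.mk (f ≫ g) = Arrow.mk g := by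
  obtain ⟨rfl, rfl⟩ := hf
  simp

theorem comp_arrow {X Y Z : C} (f : X ⟶ Y) {g : Y ⟶ Z} (hg : IsIdentity g) :
    Arrow.mk (f ≫ g) = Arrow.mk f := by
  obtain ⟨rfl, rfl⟩ := hg
  simp

theorem arrow_eq {X Y : C} {f : X ⟶ Y} (hf : IsIdentity f) : Arrow.mk f = Arrow.mk (𝟙 X) := by
  obtain ⟨rfl, rfl⟩ := hf
  rfl

end IsIdentity

/-! ### Values of words in unital magmas -/

namespace Word

/-- The value of a word in a magma with a distinguished element. -/
def value {ι M : Type*} [Mul M] [One M] (y : ι → M) : Word ι → M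
  | unit => 1
  | of i => y i
  | mul a b => value y a * value y b

/-- The element of the free unital magma given by a word. -/
def reduce {ι : Type*} (a : Word ι) : WithOne (FreeMagma ι) :=
  a.value fun i => (FreeMagma.of i : FreeMagma ι)

theorem map_value {ι M N : Type*} [MulOneClass M] [MulOneClass N] (φ : M →* N) (y : ι → M)
    (a : Word ι) : φ (a.value y) = a.value (φ ∘ y) := by
  induction a with
  | unit => exact map_one φ
  | of i => rfl
  | mul a b iha ihb => simp only [value, map_mul, iha, ihb]

theorem lift_reduce {ι M : Type*} [MulOneClass M] (y : ι → M) (a : Word ι) :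
    WithOne.lift (FreeMagma.lift y) a.reduce = a.value y := by
  rw [reduce, map_value]
  congr 1

/-- Freeness of `WithOne (FreeMagma ι)`: an identity between words that holds there holds in every
unital magma. -/
theorem value_eq_of_reduce_eq {ι M : Type*} [MulOneClass M] (y : ι → M) {a b : Word ι}
    (h : a.reduce = b.reduce) : a.value y = b.value y := by
  rw [← lift_reduce, h, lift_reduce]

/-- Substitution of words for letters. -/
def bind {ι κ : Type*} (s : ι → Word κ) : Word ι → Word κ
  | unit => unit
  | of i => s i
  | mul a b => mul (bind s a) (bind s b)

theorem value_bind {ι κ M : Type*} [Mul M] [One M] (s : ι → Word κ) (y : κ → M) (a : Word ι) :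
    (a.bind s).value y = a.value fun i => (s i).value y := by
  induction a with
  | unit => rfl
  | of i => rfl
  | mul a b iha ihb => simp only [value, bind, iha, ihb]

/-- Substitution of words for letters in a formal structure isomorphism. -/
def Path.subst {ι κ : Type*} (s : ι → Word κ) :
    ∀ {a b : Word ι}, Path a b → Path (a.bind s) (b.bind s)
  | _, _, id _ => id _
  | _, _, comp p q => comp (p.subst s) (q.subst s)
  | _, _, tensor p q => tensor (p.subst s) (q.subst s)
  | _, _, assoc _ _ _ => assoc _ _ _
  | _, _, assocInv _ _ _ => assocInv _ _ _
  | _, _, left _ => left _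
  | _, _, leftInv _ => leftInv _
  | _, _, right _ => right _
  | _, _, rightInv _ => rightInv _
  | _, _, braid _ _ => braid _ _

/-- Substitution of formal structure isomorphisms for letters. -/
def Path.bind {ι κ : Type*} {s t : ι → Word κ} (p : ∀ i, Path (s i) (t i)) :
    ∀ a : Word ι, Path (a.bind s) (a.bind t)
  | unit => id _
  | of i => p i
  | mul a b => tensor (bind p a) (bind p b)

end Word

/-- The tensor product makes arrows a magma, unital when the units of `C` are strict. Morphisms then
become values of words like any other elements, and the evaluation lemmas for operations apply to
them. -/
instance {C : Type*} [Category C] [MonoidalCategory C] : Mul (Arrow C) :=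
  ⟨fun f g => Arrow.mk (f.hom ⊗ₘ g.hom)⟩

instance {C : Type*} [Category C] [MonoidalCategory C] : One (Arrow C) :=
  ⟨Arrow.mk (𝟙 (𝟙_ C))⟩

theorem arrow_mk_mul {C : Type*} [Category C] [MonoidalCategory C] {X Y X' Y' : C} (f : X ⟶ Y)
    (g : X' ⟶ Y') : Arrow.mk f * Arrow.mk g = Arrow.mk (f ⊗ₘ g) := rfl

namespace Word

variable {ι κ C : Type*} [Category C] [MonoidalCategory C]

theorem arrow_mk_map {x y : ι → C} (f : ∀ i, x i ⟶ y i) (a : Word ι) :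
    Arrow.mk (a.map f) = a.value fun i => Arrow.mk (f i) := by
  induction a with
  | unit => rfl
  | of i => rfl
  | mul a b iha ihb => simp only [value, map, ← iha, ← ihb, arrow_mk_mul]

theorem obj_bind (s : ι → Word κ) (x : κ → C) (a : Word ι) :
    (a.bind s).obj x = a.obj fun i => (s i).obj x := by
  induction a with
  | unit => rfl
  | of i => rfl
  | mul a b iha ihb => exact congrArg₂ (· ⊗ ·) iha ihb

variable [SymmetricCategory C]

theorem Path.arrow_mk_eval_subst (s : ι → Word κ) (x : κ → C) {a b : Word ι} (p : Path a b) :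
    Arrow.mk ((p.subst s).eval x) = Arrow.mk (p.eval fun i => (s i).obj x) := by
  induction p with
  | id a => exact arrow_mk_id_congr (a.obj_bind s x)
  | comp p q ihp ihq => exact arrow_mk_comp_congr ihp ihq
  | tensor p q ihp ihq => exact congrArg₂ (· * ·) ihp ihq
  | assoc a b c =>
    exact congr (congr (congrArg (fun X Y Z : C => Arrow.mk (α_ X Y Z).hom) (a.obj_bind s x))
      (b.obj_bind s x)) (c.obj_bind s x)
  | assocInv a b c =>
    exact congr (congr (congrArg (fun X Y Z : C => Arrow.mk (α_ X Y Z).inv) (a.obj_bind s x))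
      (b.obj_bind s x)) (c.obj_bind s x)
  | left a => exact congrArg (fun X : C => Arrow.mk (λ_ X).hom) (a.obj_bind s x)
  | leftInv a => exact congrArg (fun X : C => Arrow.mk (λ_ X).inv) (a.obj_bind s x)
  | right a => exact congrArg (fun X : C => Arrow.mk (ρ_ X).hom) (a.obj_bind s x)
  | rightInv a => exact congrArg (fun X : C => Arrow.mk (ρ_ X).inv) (a.obj_bind s x)
  | braid a b =>
    exact congrArg₂ (fun X Y : C => Arrow.mk (β_ X Y).hom) (a.obj_bind s x) (b.obj_bind s x)

theorem Path.arrow_mk_eval_bind {s t : ι → Word κ} (p : ∀ i, Path (s i) (t i)) (x : κ → C)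
    (a : Word ι) : Arrow.mk ((Path.bind p a).eval x) = Arrow.mk (a.map fun i => (p i).eval x) := by
  induction a with
  | unit => rfl
  | of i => rfl
  | mul a b iha ihb => exact congrArg₂ (· * ·) iha ihb

/-! ### Strictly unital symmetric monoidal categories -/

/-- The word representing an element of the free unital magma. -/
def ofFree (a : WithOne (FreeMagma ι)) : Word ι :=
  WithOne.recOneCoe (motive := fun _ => Word ι) unit (FreeMagma.lift of) a

-- Reduction only deletes unit factors, and the unitors that do so are identities up to endpoints.
-- The path is chosen before the objects, so one path serves all families.
variable (C) in
theorem exists_path_ofFree [IsStrictlyUnital C] (a : Word ι) :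
    ∃ p : Path a (ofFree a.reduce), ∀ x : ι → C, IsIdentity (p.eval x) := by
  induction a with
  | unit => exact ⟨.id _, fun x => ⟨rfl, rfl⟩⟩
  | of i => exact ⟨.id _, fun x => ⟨rfl, rfl⟩⟩
  | mul a b iha ihb =>
    obtain ⟨p, hp⟩ := iha
    obtain ⟨q, hq⟩ := ihb
    have key : ∀ r s : WithOne (FreeMagma ι), ∃ p : Path (mul (ofFree r) (ofFree s))
        (ofFree (r * s)), ∀ x : ι → C, IsIdentity (p.eval x) := by
      intro r s
      induction r using WithOne.recOneCoe with
      | one =>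
        rw [one_mul]
        exact ⟨.left _, fun x => ⟨_, IsStrictlyUnital.leftUnitor_hom _⟩⟩
      | coe r =>
        induction s using WithOne.recOneCoe with
        | one =>
          rw [mul_one]
          exact ⟨.right _, fun x => ⟨_, IsStrictlyUnital.rightUnitor_hom _⟩⟩
        | coe s => exact ⟨.id _, fun x => ⟨rfl, rfl⟩⟩
    obtain ⟨r, hr⟩ := key a.reduce b.reduce
    exact ⟨(p.tensor q).comp r, fun x => ((hp x).tensorHom (hq x)).comp (hr x)⟩

theorem Path.isIdentity_eval_symm {x : ι → C} {a b : Word ι} {p : Path a b}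
    (hp : IsIdentity (p.eval x)) : IsIdentity (p.symm.eval x) :=
  IsIdentity.inv (e := ⟨p.eval x, p.symm.eval x, p.eval_comp_symm x, p.eval_symm_comp x⟩) hp

variable (C) in
theorem exists_path_of_reduce_eq [IsStrictlyUnital C] {a b : Word ι} (h : a.reduce = b.reduce) :
    ∃ p : Path a b, ∀ x : ι → C, IsIdentity (p.eval x) := by
  obtain ⟨p, hp⟩ := exists_path_ofFree C a
  obtain ⟨q, hq⟩ : ∃ q : Path b (ofFree a.reduce), ∀ x : ι → C, IsIdentity (q.eval x) :=
    h ▸ exists_path_ofFree C b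
  exact ⟨p.comp q.symm, fun x => (hp x).comp (Path.isIdentity_eval_symm (hq x))⟩

/-- Coherence for strictly unital symmetric monoidal categories. -/
theorem Path.arrow_mk_eval_eq [IsStrictlyUnital C] [Finite ι] (x : ι → C) {a b a' b' : Word ι}
    (hb : b.letters.Nodup) (p : Path a b) (p' : Path a' b') (h : a.reduce = a'.reduce)
    (h' : b.reduce = b'.reduce) : Arrow.mk (p.eval x) = Arrow.mk (p'.eval x) := by
  obtain ⟨q, hq⟩ := exists_path_of_reduce_eq C h
  obtain ⟨q', hq'⟩ := exists_path_of_reduce_eq C h'.symm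
  -- By coherence `p` may be replaced by the detour through `p'`, whose two outer legs are
  -- identities up to endpoints.
  rw [Path.eval_eq x hb p (q.comp (p'.comp q')), Path.eval, Path.eval, (hq x).arrow_comp,
    IsIdentity.comp_arrow _ (hq' x)]

end Word

/-- The unit laws are naturality of the unitors, read in `Arrow C` where their components disappear.
-/
instance {C : Type*} [Category C] [MonoidalCategory C] [IsStrictlyUnital C] :
    MulOneClass (Arrow C) where
  one_mul f := by
    have h : (𝟙 (𝟙_ C) ⊗ₘ f.hom) ≫ (λ_ _).hom = (λ_ _).hom ≫ f.hom := by simp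
    have := congrArg Arrow.mk h
    rw [IsIdentity.comp_arrow _ ⟨_, IsStrictlyUnital.leftUnitor_hom _⟩,
      IsIdentity.arrow_comp ⟨_, IsStrictlyUnital.leftUnitor_hom _⟩] at this
    exact this
  mul_one f := by
    have h : (f.hom ⊗ₘ 𝟙 (𝟙_ C)) ≫ (ρ_ _).hom = (ρ_ _).hom ≫ f.hom := by simp
    have := congrArg Arrow.mk h
    rw [IsIdentity.comp_arrow _ ⟨_, IsStrictlyUnital.rightUnitor_hom _⟩,
      IsIdentity.arrow_comp ⟨_, IsStrictlyUnital.rightUnitor_hom _⟩] at this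
    exact this

/-! ### Words given by the elements of the free symmetric operad -/

/-- The set of `n`-ary operations of the free symmetric operad on `V₀`. -/
abbrev LV₀ (n : ℕ) : Type := V₀ n × Equiv.Perm (Fin n)

/-- The word with given letters and a given parenthesization. -/
def V₀.word {ι : Type*} : ∀ {n : ℕ}, V₀ n → (Fin n → ι) → Word ι
  | _, .zero, _ => .unit
  | _, .ofV a, f => a.eval fun i => Word.of (f i)

theorem V₀.value_word {ι M : Type*} [MulOneClass M] (y : ι → M) {n : ℕ} (a : V₀ n)
    (f : Fin n → ι) : (a.word f).value y = a.eval fun i => y (f i) := by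
  have key : ∀ {n : ℕ} (a : V n) (f : Fin n → ι),
      (a.eval fun i => Word.of (f i)).value y = a.eval fun i => y (f i) := by
    intro n a f
    induction a with
    | one => rfl
    | pair e a b iha ihb => exact congrArg₂ (· * ·) (iha _) (ihb _)
  cases a with
  | zero => rfl
  | ofV a => exact key a f

theorem V₀.letters_word {ι : Type*} {n : ℕ} (a : V₀ n) (f : Fin n → ι) :
    (a.word f).letters = List.ofFn f := by
  have key : ∀ {n : ℕ} (a : V n) (f : Fin n → ι),
      (a.eval fun i => Word.of (f i)).letters = List.ofFn f := by
    intro n a f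
    induction a with
    | one => simp [V.eval, Word.letters]
    | pair e a b iha ihb =>
      subst e
      rw [List.ofFn_add]
      exact congrArg₂ (· ++ ·) (iha _) (ihb _)
  cases a with
  | zero => rfl
  | ofV a => exact key a f

namespace LV₀

/-- The word in the letters `Fin n` given by an `n`-ary operation. -/
def word {n : ℕ} (p : LV₀ n) : Word (Fin n) := p.1.word p.2.symm

theorem letters_perm {n : ℕ} (p : LV₀ n) : p.word.letters.Perm (List.finRange n) := by
  rw [word, V₀.letters_word, ← List.ofFn_id]
  exact Equiv.Perm.ofFn_comp_perm p.2.symm id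

theorem nodup_letters {n : ℕ} (p : LV₀ n) : p.word.letters.Nodup :=
  p.letters_perm.nodup_iff.2 (List.nodup_finRange n)

theorem value_word {M : Type*} [MulOneClass M] {n : ℕ} (p : LV₀ n) (y : Fin n → M) :
    p.word.value y = p.1.eval fun i => y (p.2.symm i) :=
  p.1.value_word y _

/-- Composition in the free symmetric operad on `V₀`. -/
def comp {n m : ℕ} (k : Fin n → ℕ) (h : ∑ i, k i = m) (p : LV₀ n) (r : ∀ i, LV₀ (k i)) : LV₀ m :=
  (freeSymm V₀Operad).comp k h p r

/-- The action of permutations on the free symmetric operad on `V₀`. -/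
def perm {n : ℕ} (σ : Equiv.Perm (Fin n)) (p : LV₀ n) : LV₀ n := (p.1, p.2 * σ)

/-- Composition of operations is substitution of words. The letters are placed by inverse
permutations, and the inverse of the composite block permutation moves each block by `σ⁻¹` and its
entries by the respective `τ⁻¹`. -/
theorem value_word_comp {M : Type*} [MulOneClass M] {n m : ℕ} (k : Fin n → ℕ)
    (h : ∑ i, k i = m) (p : LV₀ n) (r : ∀ i, LV₀ (k i)) (y : Fin m → M) :
    (comp k h p r).word.value y =
      p.word.value fun i => (r i).word.value fun j => y (blockEquiv k h ⟨i, j⟩) := by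
  rw [value_word, value_word]
  simp only [value_word]
  refine (V₀.eval_comp p.1 _ _ _ _).trans ?_
  congr 1
  funext i
  congr 1
  funext j
  exact congrArg y (permComp_symm_apply k h p.2 (fun i => (r i).2) i j)

theorem value_word_perm {M : Type*} [MulOneClass M] {n : ℕ} (σ : Equiv.Perm (Fin n)) (p : LV₀ n)
    (y : Fin n → M) :
    (perm σ p).word.value y = p.word.value fun i => y (σ.symm i) := by
  rw [value_word, value_word]
  rfl

/-- The formal structure isomorphism between the words given by two operations. -/
noncomputable def path {n : ℕ} (p q : LV₀ n) : Word.Path p.word q.word :=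
  (Word.nonempty_path (p.letters_perm.trans q.letters_perm.symm)).some

end LV₀

/-! ### The algebra given by a strictly unital symmetric monoidal category -/

section

variable (C : Type*) [Category C] [MonoidalCategory C] [SymmetricCategory C]

/-- The action of `ELV₀` on a symmetric monoidal category. -/
noncomputable def symmAct (n : ℕ) : ELV₀.Op n × (Fin n → C) ⥤ C where
  obj P := (LV₀.word P.1.as).obj P.2
  map {P Q} g := (LV₀.word P.1.as).map g.2 ≫ (LV₀.path P.1.as Q.1.as).eval Q.2
  map_id P := by
    -- The letters of an operation are distinct, so coherence allows the arbitrarily chosen path to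
    -- be exchanged for any parallel one.
    rw [Word.Path.eval_eq P.2 (LV₀.nodup_letters P.1.as) (LV₀.path _ _) (.id _)]
    exact (Category.comp_id _).trans (Word.map_id _ _)
  map_comp {P Q R} g h := by
    rw [Word.Path.eval_eq R.2 (LV₀.nodup_letters R.1.as) (LV₀.path P.1.as R.1.as)
      ((LV₀.path P.1.as Q.1.as).comp (LV₀.path Q.1.as R.1.as)), Word.Path.eval]
    simp only [Category.assoc]
    rw [← reassoc_of% (LV₀.path P.1.as Q.1.as).naturality h.2]
    exact (congrArg (· ≫ _) (Word.map_comp g.2 h.2 _)).trans (Category.assoc _ _ _)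

/-- The `ELV₀`-algebra given by a strictly unital symmetric monoidal category. -/
noncomputable def symmAlgebra [IsStrictlyUnital C] : ELV₀.Algebra C where
  act := symmAct C
  act_one := by
    refine Arrow.functor_ext fun X Y f => ?_
    let p : LV₀ 1 := (V₀.ofV V.one, 1)
    change Arrow.mk (p.word.map (fun _ => f) ≫ (p.path p).eval fun _ => Y) = Arrow.mk f
    rw [Word.Path.eval_eq _ p.nodup_letters (p.path p) (.id _)]
    exact congrArg Arrow.mk (Category.comp_id f)
  act_comp {n m} k h := by
    refine Arrow.functor_ext fun X Y φ => ?_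
    let p : LV₀ n := X.1.1.as
    let q : LV₀ n := Y.1.1.as
    let r (i : Fin n) : LV₀ (k i) := (X.1.2 i).as
    let s (i : Fin n) : LV₀ (k i) := (Y.1.2 i).as
    let x : Fin m → C := X.2
    let y : Fin m → C := Y.2
    let f : ∀ i, x i ⟶ y i := φ.2
    change Arrow.mk ((LV₀.comp k h p r).word.map f ≫
        (LV₀.path (LV₀.comp k h p r) (LV₀.comp k h q s)).eval y) =
      Arrow.mk (p.word.map (fun i => (r i).word.map (fun j => f (blockEquiv k h ⟨i, j⟩)) ≫
        ((r i).path (s i)).eval (fun j => y (blockEquiv k h ⟨i, j⟩))) ≫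
          (p.path q).eval fun i => (s i).word.obj fun j => y (blockEquiv k h ⟨i, j⟩))
    rw [Word.map_comp, Category.assoc]
    -- Letter `j` of the `i`-th inner operation becomes its position in the concatenation of all
    -- blocks.
    let b (i : Fin n) (j : Fin (k i)) : Word (Fin m) := .of (blockEquiv k h ⟨i, j⟩)
    have hred : ∀ (p : LV₀ n) (r : ∀ i, LV₀ (k i)), (LV₀.comp k h p r).word.reduce =
        (p.word.bind fun i => (r i).word.bind (b i)).reduce := by
      intro p r
      rw [Word.reduce, Word.reduce, LV₀.value_word_comp, Word.value_bind]
      simp only [Word.value_bind]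
      rfl
    -- The factors coming from `f` agree because both are values of words in the unital magma of
    -- arrows; the remaining factors are structure isomorphisms.
    refine arrow_mk_comp_congr ?_ ?_
    · simp only [Word.arrow_mk_map, LV₀.value_word_comp]
    -- The right-hand side is the value of a single formal path, inner paths followed by the outer
    -- one, whose endpoints reduce to those of the left-hand path; coherence with strict units
    -- applies.
    · refine (Word.Path.arrow_mk_eval_eq y (LV₀.nodup_letters _) _
        ((Word.Path.bind (fun i => ((r i).path (s i)).subst (b i)) p.word).comp
          ((p.path q).subst fun i => (s i).word.bind (b i))) (hred _ _) (hred _ _)).trans ?_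
      refine arrow_mk_comp_congr ?_ ?_
      · rw [Word.Path.arrow_mk_eval_bind, Word.arrow_mk_map, Word.arrow_mk_map]
        simp only [Word.Path.arrow_mk_eval_subst]
        rfl
      · rw [Word.Path.arrow_mk_eval_subst]
        exact congrArg (fun z => Arrow.mk ((p.path q).eval z))
          (funext fun i => Word.obj_bind (b i) y (s i).word)
  act_perm {n} σ := by
    refine Arrow.functor_ext fun X Y φ => ?_
    let p : LV₀ n := X.1.as
    let q : LV₀ n := Y.1.as
    let x : Fin n → C := X.2
    let y : Fin n → C := Y.2
    let f : ∀ i, x i ⟶ y i := φ.2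
    change Arrow.mk ((LV₀.perm σ p).word.map f ≫
        (LV₀.path (LV₀.perm σ p) (LV₀.perm σ q)).eval y) =
      Arrow.mk (p.word.map (fun i => f (σ.symm i)) ≫ (p.path q).eval fun i => y (σ.symm i))
    have hred : ∀ p : LV₀ n, (LV₀.perm σ p).word.reduce =
        (p.word.bind fun i => .of (σ.symm i)).reduce := by
      intro p
      rw [Word.reduce, Word.reduce, LV₀.value_word_perm, Word.value_bind]
      rfl
    refine arrow_mk_comp_congr ?_ ?_
    · simp only [Word.arrow_mk_map, LV₀.value_word_perm]
    · refine (Word.Path.arrow_mk_eval_eq y (LV₀.nodup_letters _) _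
        ((p.path q).subst fun i => .of (σ.symm i)) (hred _) (hred _)).trans ?_
      exact Word.Path.arrow_mk_eval_subst _ _ _

end

end OperadSMC

namespace OperadSMC

/-! ### Algebras as actions on arrows -/

/-- `h` is the composite of `f` and `g`, up to equality of endpoints. -/
def IsComp {C : Type*} [Category C] (f g h : Arrow C) : Prop :=
  ∃ (X Y Z : C) (a : X ⟶ Y) (b : Y ⟶ Z),
    f = Arrow.mk a ∧ g = Arrow.mk b ∧ h = Arrow.mk (a ≫ b)

namespace IsComp

variable {C : Type*} [Category C]

theorem mk {X Y Z : C} (a : X ⟶ Y) (b : Y ⟶ Z) :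
    IsComp (Arrow.mk a) (Arrow.mk b) (Arrow.mk (a ≫ b)) :=
  ⟨_, _, _, a, b, rfl, rfl, rfl⟩

theorem id_left (f : Arrow C) : IsComp (Arrow.mk (𝟙 f.left)) f f :=
  ⟨_, _, _, 𝟙 _, f.hom, rfl, rfl, by rw [Category.id_comp]; rfl⟩

theorem id_right (f : Arrow C) : IsComp f (Arrow.mk (𝟙 f.right)) f :=
  ⟨_, _, _, f.hom, 𝟙 _, rfl, rfl, by rw [Category.comp_id]; rfl⟩

theorem unique {f g h h' : Arrow C} (H : IsComp f g h) (H' : IsComp f g h') : h = h' := by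
  obtain ⟨X, Y, Z, a, b, rfl, rfl, rfl⟩ := H
  obtain ⟨X', Y', Z', a', b', ha, hb, rfl⟩ := H'
  exact arrow_mk_comp_congr ha hb

end IsComp

namespace CatOperad.Algebra

variable {C : Type*} [Category C] (A : ELV₀.Algebra C)

/-- The value of an algebra structure on objects. -/
def obj {n : ℕ} (p : LV₀ n) (x : Fin n → C) : C := (A.act n).obj (⟨p⟩, x)

/-- The value of an algebra structure on morphisms. -/
def hom {n : ℕ} (p q : LV₀ n) {x y : Fin n → C} (f : ∀ i, x i ⟶ y i) : A.obj p x ⟶ A.obj q y :=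
  (A.act n).map (X := (⟨p⟩, x)) (Y := (⟨q⟩, y)) (CategoryTheory.Prod.mkHom () f)

theorem hom_id {n : ℕ} (p : LV₀ n) (x : Fin n → C) : A.hom p p (fun i => 𝟙 (x i)) = 𝟙 _ :=
  (A.act n).map_id (⟨p⟩, x)

theorem hom_comp {n : ℕ} (p q r : LV₀ n) {x y z : Fin n → C} (f : ∀ i, x i ⟶ y i)
    (g : ∀ i, y i ⟶ z i) : A.hom p q f ≫ A.hom q r g = A.hom p r (fun i => f i ≫ g i) :=
  ((A.act n).map_comp (X := (⟨p⟩, x)) (Y := (⟨q⟩, y)) (Z := (⟨r⟩, z))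
    (CategoryTheory.Prod.mkHom () f) (CategoryTheory.Prod.mkHom () g)).symm

/-- The action of pairs of operations on arrows. -/
def arr {n : ℕ} (p q : LV₀ n) (f : Fin n → Arrow C) : Arrow C :=
  Arrow.mk (A.hom p q fun i => (f i).hom)

theorem arr_one (f : Fin 1 → Arrow C) :
    A.arr (V₀.ofV V.one, 1) (V₀.ofV V.one, 1) f = f 0 := by
  have h := congrArg (fun F => F.mapArrow.obj (f 0)) A.act_one
  refine Eq.trans ?_ h
  have : f = fun _ => f 0 := by
    funext i
    rw [Subsingleton.elim i 0]
  rw [this]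
  rfl

theorem arr_comp {n m : ℕ} (k : Fin n → ℕ) (h : ∑ i, k i = m) (p q : LV₀ n)
    (r s : ∀ i, LV₀ (k i)) (f : Fin m → Arrow C) :
    A.arr (LV₀.comp k h p r) (LV₀.comp k h q s) f =
      A.arr p q fun i => A.arr (r i) (s i) fun j => f (blockEquiv k h ⟨i, j⟩) :=
  congrArg (fun F => F.mapArrow.obj (Arrow.mk (CategoryTheory.Prod.mkHom
    (X₁ := ((⟨p⟩, fun i => ⟨r i⟩) : ELV₀.Op n × (∀ i, ELV₀.Op (k i))))
    (X₂ := ((⟨q⟩, fun i => ⟨s i⟩) : ELV₀.Op n × (∀ i, ELV₀.Op (k i))))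
    (Y₁ := fun i => (f i).left) (Y₂ := fun i => (f i).right)
    (CategoryTheory.Prod.mkHom () (fun _ => ())) (fun i => (f i).hom)))) (A.act_comp k h)

theorem arr_perm {n : ℕ} (σ : Equiv.Perm (Fin n)) (p q : LV₀ n) (f : Fin n → Arrow C) :
    A.arr (LV₀.perm σ p) (LV₀.perm σ q) f = A.arr p q fun i => f (σ.symm i) :=
  congrArg (fun F => F.mapArrow.obj (Arrow.mk (CategoryTheory.Prod.mkHom
    (X₁ := (⟨p⟩ : ELV₀.Op n)) (X₂ := (⟨q⟩ : ELV₀.Op n))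
    (Y₁ := fun i => (f i).left) (Y₂ := fun i => (f i).right) () (fun i => (f i).hom)))) (A.act_perm σ)

theorem isComp_arr {n : ℕ} (p q r : LV₀ n) {f g h : Fin n → Arrow C}
    (H : ∀ i, IsComp (f i) (g i) (h i)) : IsComp (A.arr p q f) (A.arr q r g) (A.arr p r h) := by
  choose X Y Z a b hf hg hh using H
  obtain rfl := funext hf
  obtain rfl := funext hg
  obtain rfl := funext hh
  exact ⟨_, _, _, A.hom p q a, A.hom q r b, rfl, rfl, congrArg Arrow.mk (A.hom_comp p q r a b).symm⟩

end CatOperad.Algebra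

/-! ### Operations are determined by their words -/

namespace Word

/-- The list of letters is the value of the word in the free monoid, which is a unital magma. -/
theorem letters_eq_of_reduce_eq {ι : Type*} {a b : Word ι} (h : a.reduce = b.reduce) :
    a.letters = b.letters := by
  have key : ∀ a : Word ι, a.value FreeMonoid.of = FreeMonoid.ofList a.letters := by
    intro a
    induction a with
    | unit => rfl
    | of i => rfl
    | mul a b iha ihb => exact congrArg₂ (· * ·) iha ihb
  have := value_eq_of_reduce_eq FreeMonoid.of h
  rwa [key, key] at this

theorem letters_bind_of {ι κ : Type*} (g : ι → κ) (a : Word ι) :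
    (a.bind fun i => of (g i)).letters = a.letters.map g := by
  induction a with
  | unit => rfl
  | of i => rfl
  | mul a b iha ihb => simp only [bind, letters, iha, ihb, List.map_append]

end Word

namespace LV₀

/-- The word obtained from an `n`-ary operation by relabelling. -/
def wordOf {ι : Type*} {n : ℕ} (p : LV₀ n) (g : Fin n → ι) : Word ι :=
  p.word.bind fun i => .of (g i)

theorem letters_wordOf {ι : Type*} {n : ℕ} (p : LV₀ n) (g : Fin n → ι) :
    (p.wordOf g).letters = List.ofFn fun i => g (p.2.symm i) := by
  rw [wordOf, Word.letters_bind_of, word, V₀.letters_word, List.map_ofFn]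
  rfl

theorem raw_eq_of_reduce_eq {ι : Type*} {n n' : ℕ} {p : LV₀ n} {q : LV₀ n'} {g : Fin n → ι}
    {g' : Fin n' → ι} (h : (p.wordOf g).reduce = (q.wordOf g').reduce) : p.1.raw = q.1.raw := by
  have := Word.value_eq_of_reduce_eq
    (fun _ => ((FreeMagma.of () : FreeMagma Unit) : FreeUnitalMagma)) h
  rwa [wordOf, wordOf, Word.value_bind, Word.value_bind, value_word, value_word] at this

/-- Two presentations of the same element of the free unital magma differ by a permutation. -/
theorem exists_perm {ι : Type*} {n n' : ℕ} {p : LV₀ n} {q : LV₀ n'} {g : Fin n → ι}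
    {g' : Fin n' → ι} (h : (p.wordOf g).reduce = (q.wordOf g').reduce) :
    ∃ (e : n' = n) (σ : Equiv.Perm (Fin n)), e ▸ q = perm σ p ∧
      ∀ i, g i = g' (Fin.cast e.symm (σ.symm i)) := by
  have hl := Word.letters_eq_of_reduce_eq h
  rw [letters_wordOf, letters_wordOf] at hl
  obtain rfl : n' = n := by simpa using (congrArg List.length hl).symm
  -- The permutation is forced by `perm σ p = q`; equality of the letter lists then says that it
  -- matches the two labellings.
  refine ⟨rfl, p.2⁻¹ * q.2, Prod.ext (V₀.raw_injective (raw_eq_of_reduce_eq h)).symm ?_, ?_⟩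
  · simp [perm]
  · intro i
    have := congrFun (List.ofFn_injective hl) (p.2 i)
    rw [Equiv.symm_apply_apply] at this
    exact this

end LV₀

/-! ### Realization of structure isomorphisms by an algebra -/

namespace CatOperad.Algebra

variable {C : Type*} [Category C] (A : ELV₀.Algebra C) {ι : Type*}

/-- The arrow `f` is given by the action of the isomorphism between two operations with words
`a` and `b`. -/
def Realizes (y : ι → Arrow C) (a b : Word ι) (f : Arrow C) : Prop :=
  ∃ (n : ℕ) (g : Fin n → ι) (p q : LV₀ n), (p.wordOf g).reduce = a.reduce ∧
    (q.wordOf g).reduce = b.reduce ∧ f = A.arr p q fun i => y (g i)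

namespace Realizes

variable {A} {y : ι → Arrow C} {a b c : Word ι} {f g h : Arrow C}

theorem congr {a' b' : Word ι} (H : A.Realizes y a b f) (ha : a.reduce = a'.reduce)
    (hb : b.reduce = b'.reduce) : A.Realizes y a' b' f := by
  obtain ⟨n, l, p, q, hp, hq, hf⟩ := H
  exact ⟨n, l, p, q, hp.trans ha, hq.trans hb, hf⟩

theorem word {n : ℕ} (p q : LV₀ n) (y : Fin n → Arrow C) :
    A.Realizes y p.word q.word (A.arr p q y) := by
  have key : ∀ p : LV₀ n, (p.wordOf id).reduce = p.word.reduce := by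
    intro p
    rw [LV₀.wordOf, Word.reduce, Word.value_bind]
    rfl
  exact ⟨n, id, p, q, key p, key q, rfl⟩

/-- Changing the presentation of the source. -/
theorem exists_of_source {n : ℕ} {p : LV₀ n} {l : Fin n → ι} (H : A.Realizes y a b f)
    (h : (p.wordOf l).reduce = a.reduce) : ∃ q : LV₀ n, (q.wordOf l).reduce = b.reduce ∧
      f = A.arr p q fun i => y (l i) := by
  obtain ⟨n', l', p', q', hp, hq, rfl⟩ := H
  obtain ⟨rfl, σ, h1, h2⟩ := LV₀.exists_perm (h.trans hp.symm)
  obtain rfl : p' = LV₀.perm σ p := h1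
  obtain rfl : l = fun i => l' (σ.symm i) := funext h2
  -- Equivariance permutes source and target together, so the permutation relating the sources is
  -- undone on the target.
  refine ⟨LV₀.perm σ⁻¹ q', ?_, ?_⟩
  · rw [← hq, LV₀.wordOf, LV₀.wordOf, Word.reduce, Word.reduce, Word.value_bind,
      LV₀.value_word_perm, Word.value_bind]
    congr 1
    funext i
    exact congrArg (fun j => (Word.of (l' j)).value _) (σ.symm_apply_apply i)
  · rw [← A.arr_perm σ p (LV₀.perm σ⁻¹ q') fun i => y (l' i)]
    congr 1
    simp [LV₀.perm]

/-- With a common source presentation, the two targets differ by a permutation preserving the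
labelling; distinct letters make the labelling injective and this permutation trivial. With a
repeated letter, both the identity and the braiding of `a ⊗ a` would realize the same pair. -/
theorem unique (ha : a.letters.Nodup) (H : A.Realizes y a b f) (H' : A.Realizes y a b g) :
    f = g := by
  obtain ⟨n, l, p, q, hp, hq, rfl⟩ := H
  obtain ⟨q', hq', rfl⟩ := H'.exists_of_source hp
  have hl : Function.Injective l := by
    rw [← Word.letters_eq_of_reduce_eq hp, LV₀.letters_wordOf, List.nodup_ofFn] at ha
    intro i j hij
    exact p.2.injective.eq_iff.1 (p.2.symm.injective.eq_iff.1 (p.2.injective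
      (by simpa using congrArg p.2 (ha (a₁ := p.2 i) (a₂ := p.2 j) (by simpa using hij)))))
  obtain ⟨_, σ, h1, h2⟩ := LV₀.exists_perm (hq.trans hq'.symm)
  obtain rfl : q' = LV₀.perm σ q := h1
  have h2 : ∀ i, l i = l (σ.symm i) := h2
  have hσ : σ = 1 := by
    ext i
    have := hl (h2 (σ i))
    simp at this
    simp [this]
  subst hσ
  simp [LV₀.perm]

/-- Once the middle word has the same presentation on both sides, this is functoriality of the
action. -/
theorem comp {y z w : ι → Arrow C} (H : A.Realizes y a b f) (H' : A.Realizes z b c g)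
    (hy : ∀ i, IsComp (y i) (z i) (w i)) (hf : IsComp f g h) : A.Realizes w a c h := by
  obtain ⟨n, l, p, q, hp, hq, rfl⟩ := H
  obtain ⟨r, hr, rfl⟩ := H'.exists_of_source hq
  exact ⟨n, l, p, r, hp, hr, hf.unique (A.isComp_arr p q r fun i => hy (l i))⟩

theorem of (y : ι → Arrow C) (i : ι) : A.Realizes y (.of i) (.of i) (y i) :=
  ⟨1, fun _ => i, (V₀.ofV V.one, 1), (V₀.ofV V.one, 1), rfl, rfl, (A.arr_one fun _ => y i).symm⟩

/-- The composition axiom of the algebra: the presentations of the inputs are placed side by side as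
blocks, with the concatenated labelling `l'`. -/
theorem arr {n : ℕ} (p q : LV₀ n) {s t : Fin n → Word ι} {f : Fin n → Arrow C}
    (H : ∀ i, A.Realizes y (s i) (t i) (f i)) :
    A.Realizes y (p.word.bind s) (q.word.bind t) (A.arr p q f) := by
  choose k l r r' hr hr' hf using H
  let m := ∑ i, k i
  let l' (b : Fin m) : ι := l ((blockEquiv k rfl).symm b).1 ((blockEquiv k rfl).symm b).2
  have hl' : ∀ i j, l' (blockEquiv k rfl ⟨i, j⟩) = l i j := by
    intro i j
    simp only [l']
    rw [Equiv.symm_apply_apply]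
  have key : ∀ (p : LV₀ n) (r : ∀ i, LV₀ (k i)) (s : Fin n → Word ι),
      (∀ i, ((r i).wordOf (l i)).reduce = (s i).reduce) →
      ((LV₀.comp k rfl p r).wordOf l').reduce = (p.word.bind s).reduce := by
    intro p r s h
    rw [LV₀.wordOf, Word.reduce, Word.reduce, Word.value_bind, LV₀.value_word_comp,
      Word.value_bind]
    congr 1
    funext i
    refine Eq.trans ?_ (h i)
    rw [LV₀.wordOf, Word.reduce, Word.value_bind]
    congr 1
    funext j
    rw [hl']
  refine ⟨m, l', LV₀.comp k rfl p r, LV₀.comp k rfl q r', key p r s hr, key q r' t hr', ?_⟩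
  rw [A.arr_comp, funext hf]
  simp only [hl']

end Realizes

end CatOperad.Algebra

end OperadSMC

/-! ### The generating operations and their strict identities -/

namespace OperadSMC

namespace LV₀

/-- The nullary operation `0`. -/
def zeroOp : LV₀ 0 := (V₀.zero, 1)

/-- The binary operation `(1, 1)`. -/
def mulOp : LV₀ 2 := (V₀.ofV (.pair rfl .one .one), 1)

/-- The binary operation `(1, 1)`, with the transposition. -/
def swapOp : LV₀ 2 := (V₀.ofV (.pair rfl .one .one), Equiv.swap 0 1)

/-- The ternary operation `((1, 1), 1)`. -/
def leftOp : LV₀ 3 := (V₀.ofV (.pair rfl (.pair rfl .one .one) .one), 1)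

/-- The ternary operation `(1, (1, 1))`. -/
def rightOp : LV₀ 3 := (V₀.ofV (.pair rfl .one (.pair rfl .one .one)), 1)

end LV₀

open LV₀

theorem homPair_id {C : Type u} [Category.{v} C] (X Y : C) :
    homPair (𝟙 X) (𝟙 Y) = fun i => 𝟙 ((![X, Y] : Fin 2 → C) i) := by
  funext i
  fin_cases i <;> rfl

theorem homPair_comp {C : Type u} [Category.{v} C] {X X' X'' Y Y' Y'' : C} (f : X ⟶ X')
    (f' : X' ⟶ X'') (g : Y ⟶ Y') (g' : Y' ⟶ Y'') :
    homPair (f ≫ f') (g ≫ g') = fun i => homPair f g i ≫ homPair f' g' i := by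
  funext i
  fin_cases i <;> rfl

namespace CatOperad.Algebra

variable {C : Type u} [Category.{v} C] (A : ELV₀.Algebra C)

theorem arr_eq {n : ℕ} (p q : LV₀ n) {x y : Fin n → C} (f : ∀ i, x i ⟶ y i)
    (φ : Fin n → Arrow C) (h : ∀ i, φ i = Arrow.mk (f i)) :
    A.arr p q φ = Arrow.mk (A.hom p q f) := by
  obtain rfl := funext h
  rfl

theorem arr_id {n : ℕ} (p : LV₀ n) (x : Fin n → C) (φ : Fin n → Arrow C)
    (h : ∀ i, φ i = Arrow.mk (𝟙 (x i))) : A.arr p p φ = Arrow.mk (𝟙 (A.obj p x)) := by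
  rw [A.arr_eq p p _ φ h, hom_id]

/-- The action of the unique isomorphism between two operations. -/
def iso {n : ℕ} (p q : LV₀ n) (x : Fin n → C) : A.obj p x ≅ A.obj q x where
  hom := A.hom p q fun i => 𝟙 (x i)
  inv := A.hom q p fun i => 𝟙 (x i)
  hom_inv_id := by simp only [hom_comp, Category.comp_id, hom_id]
  inv_hom_id := by simp only [hom_comp, Category.comp_id, hom_id]

theorem arrow_mk_homPair {X X' Y Y' : C} (f : X ⟶ X') (g : Y ⟶ Y') :
    Arrow.mk (A.hom mulOp mulOp (homPair f g)) =
      A.arr mulOp mulOp ![Arrow.mk f, Arrow.mk g] := by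
  refine (A.arr_eq _ _ _ _ fun i => ?_).symm
  fin_cases i <;> rfl

namespace Realizes

variable {A} {ι : Type*} {y : ι → Arrow C} {a b c d : Word ι} {f g h : Arrow C}

theorem zero : A.Realizes y .unit .unit (A.arr zeroOp zeroOp ![]) :=
  Realizes.arr zeroOp zeroOp (s := ![]) (t := ![]) fun i => i.elim0

theorem mul (H : A.Realizes y a b f) (H' : A.Realizes y c d g) :
    A.Realizes y (a.mul c) (b.mul d) (A.arr mulOp mulOp ![f, g]) :=
  Realizes.arr mulOp mulOp (s := ![a, c]) (t := ![b, d]) fun i => by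
    fin_cases i
    exacts [H, H']

theorem mulSwap (H : A.Realizes y a a f) (H' : A.Realizes y b b g) :
    A.Realizes y (a.mul b) (b.mul a) (A.arr mulOp swapOp ![f, g]) :=
  Realizes.arr mulOp swapOp (s := ![a, b]) (t := ![a, b]) fun i => by
    fin_cases i
    exacts [H, H']

theorem leftRight (H : A.Realizes y a a f) (H' : A.Realizes y b b g) (H'' : A.Realizes y c c h) :
    A.Realizes y ((a.mul b).mul c) (a.mul (b.mul c)) (A.arr leftOp rightOp ![f, g, h]) :=
  Realizes.arr leftOp rightOp (s := ![a, b, c]) (t := ![a, b, c]) fun i => by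
    fin_cases i
    exacts [H, H', H'']

theorem rightLeft (H : A.Realizes y a a f) (H' : A.Realizes y b b g) (H'' : A.Realizes y c c h) :
    A.Realizes y (a.mul (b.mul c)) ((a.mul b).mul c) (A.arr rightOp leftOp ![f, g, h]) :=
  Realizes.arr rightOp leftOp (s := ![a, b, c]) (t := ![a, b, c]) fun i => by
    fin_cases i
    exacts [H, H', H'']

/-- Together with `comp_left` this gives the two sides of a naturality square: structure
isomorphisms are realized over identities of the targets, or of the sources, of the letters. -/
theorem comp_right {X Y Z : C} {f : X ⟶ Y} {g : Y ⟶ Z} (H : A.Realizes y a b (Arrow.mk f))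
    (H' : A.Realizes (fun i => Arrow.mk (𝟙 (y i).right)) b c (Arrow.mk g)) :
    A.Realizes y a c (Arrow.mk (f ≫ g)) :=
  H.comp H' (fun i => IsComp.id_right (y i)) (IsComp.mk f g)

theorem comp_left {X Y Z : C} {f : X ⟶ Y} {g : Y ⟶ Z}
    (H : A.Realizes (fun i => Arrow.mk (𝟙 (y i).left)) a b (Arrow.mk f))
    (H' : A.Realizes y b c (Arrow.mk g)) : A.Realizes y a c (Arrow.mk (f ≫ g)) :=
  H.comp H' (fun i => IsComp.id_left (y i)) (IsComp.mk f g)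

end Realizes

/-- Both sides realize the word with one letter, because the unit factor disappears in the free
unital magma. -/
theorem one_mul_arrow (f : Arrow C) : A.arr mulOp mulOp ![A.arr zeroOp zeroOp ![], f] = f := by
  have H : A.Realizes (fun _ : Unit => f) (.of ()) (.of ()) f := .of _ ()
  exact ((Realizes.zero.mul H).congr (one_mul _) (one_mul _)).unique (by simp [Word.letters]) H

theorem mul_one_arrow (f : Arrow C) : A.arr mulOp mulOp ![f, A.arr zeroOp zeroOp ![]] = f := by
  have H : A.Realizes (fun _ : Unit => f) (.of ()) (.of ()) f := .of _ ()
  exact ((H.mul .zero).congr (mul_one _) (mul_one _)).unique (by simp [Word.letters]) H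

theorem zero_arrow : A.arr zeroOp zeroOp ![] = Arrow.mk (𝟙 (A.obj zeroOp ![])) :=
  A.arr_id _ _ _ fun i => i.elim0

/-- An equality of objects is read off as the source of an equality of arrows. -/
theorem unit_tensor (X : C) : A.obj mulOp ![A.obj zeroOp ![], X] = X := by
  have h := A.one_mul_arrow (Arrow.mk (𝟙 X))
  rw [zero_arrow, ← arrow_mk_homPair] at h
  exact congrArg Comma.left h

theorem tensor_unit (X : C) : A.obj mulOp ![X, A.obj zeroOp ![]] = X := by
  have h := A.mul_one_arrow (Arrow.mk (𝟙 X))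
  rw [zero_arrow, ← arrow_mk_homPair] at h
  exact congrArg Comma.left h

theorem left_arrow (f g h : Arrow C) :
    A.arr leftOp leftOp ![f, g, h] = A.arr mulOp mulOp ![A.arr mulOp mulOp ![f, g], h] := by
  have H : ∀ i, A.Realizes ![f, g, h] (.of i) (.of i) (![f, g, h] i) := fun i => .of _ i
  exact (Realizes.word _ _ _).unique leftOp.nodup_letters (((H 0).mul (H 1)).mul (H 2))

theorem right_arrow (f g h : Arrow C) :
    A.arr rightOp rightOp ![f, g, h] = A.arr mulOp mulOp ![f, A.arr mulOp mulOp ![g, h]] := by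
  have H : ∀ i, A.Realizes ![f, g, h] (.of i) (.of i) (![f, g, h] i) := fun i => .of _ i
  exact (Realizes.word _ _ _).unique rightOp.nodup_letters ((H 0).mul ((H 1).mul (H 2)))

theorem swap_arrow (f g : Arrow C) :
    A.arr swapOp swapOp ![f, g] = A.arr mulOp mulOp ![g, f] := by
  have H : ∀ i, A.Realizes ![f, g] (.of i) (.of i) (![f, g] i) := fun i => .of _ i
  exact (Realizes.word _ _ _).unique swapOp.nodup_letters ((H 1).mul (H 0))

theorem mul_arrow_id (X Y : C) : A.arr mulOp mulOp ![Arrow.mk (𝟙 X), Arrow.mk (𝟙 Y)] =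
    Arrow.mk (𝟙 (A.obj mulOp ![X, Y])) :=
  A.arr_id _ _ _ fun i => by fin_cases i <;> rfl

theorem obj_left (X Y Z : C) :
    A.obj mulOp ![A.obj mulOp ![X, Y], Z] = A.obj leftOp ![X, Y, Z] := by
  have h := A.left_arrow (Arrow.mk (𝟙 X)) (Arrow.mk (𝟙 Y)) (Arrow.mk (𝟙 Z))
  rw [A.arr_id leftOp ![X, Y, Z] _ (by intro i; fin_cases i <;> rfl), mul_arrow_id, mul_arrow_id] at h
  exact (congrArg Comma.left h).symm

theorem obj_right (X Y Z : C) :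
    A.obj rightOp ![X, Y, Z] = A.obj mulOp ![X, A.obj mulOp ![Y, Z]] := by
  have h := A.right_arrow (Arrow.mk (𝟙 X)) (Arrow.mk (𝟙 Y)) (Arrow.mk (𝟙 Z))
  rw [A.arr_id rightOp ![X, Y, Z] _ (by intro i; fin_cases i <;> rfl), mul_arrow_id, mul_arrow_id] at h
  exact congrArg Comma.left h

theorem obj_swap (X Y : C) : A.obj swapOp ![X, Y] = A.obj mulOp ![Y, X] := by
  have h := A.swap_arrow (Arrow.mk (𝟙 X)) (Arrow.mk (𝟙 Y))
  rw [A.arr_id swapOp ![X, Y] _ (by intro i; fin_cases i <;> rfl), mul_arrow_id] at h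
  exact congrArg Comma.left h

/-! ### The symmetric monoidal structure given by an algebra -/

/-- The data of the monoidal structure given by an algebra. -/
@[reducible]
def monoidalStruct : MonoidalCategoryStruct C where
  tensorObj X Y := A.obj mulOp ![X, Y]
  whiskerLeft X _ _ f := A.hom mulOp mulOp (homPair (𝟙 X) f)
  whiskerRight f Y := A.hom mulOp mulOp (homPair f (𝟙 Y))
  tensorHom f g := A.hom mulOp mulOp (homPair f g)
  tensorUnit := A.obj zeroOp ![]
  associator X Y Z := eqToIso (A.obj_left X Y Z) ≪≫ A.iso leftOp rightOp ![X, Y, Z] ≪≫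
    eqToIso (A.obj_right X Y Z)
  leftUnitor X := eqToIso (A.unit_tensor X)
  rightUnitor X := eqToIso (A.tensor_unit X)

theorem arrow_mk_associator (X Y Z : C) : letI := A.monoidalStruct
    Arrow.mk (α_ X Y Z).hom =
      A.arr leftOp rightOp ![Arrow.mk (𝟙 X), Arrow.mk (𝟙 Y), Arrow.mk (𝟙 Z)] := by
  rw [A.arr_eq leftOp rightOp (fun i => 𝟙 (![X, Y, Z] i)) _
    (by intro i; fin_cases i <;> rfl)]
  change Arrow.mk (eqToIso _ ≪≫ A.iso leftOp rightOp ![X, Y, Z] ≪≫ eqToIso _).hom = _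
  simp [iso]

theorem arrow_mk_associator_inv (X Y Z : C) : letI := A.monoidalStruct
    Arrow.mk (α_ X Y Z).inv =
      A.arr rightOp leftOp ![Arrow.mk (𝟙 X), Arrow.mk (𝟙 Y), Arrow.mk (𝟙 Z)] := by
  rw [A.arr_eq rightOp leftOp (fun i => 𝟙 (![X, Y, Z] i)) _
    (by intro i; fin_cases i <;> rfl)]
  change Arrow.mk (eqToIso _ ≪≫ A.iso leftOp rightOp ![X, Y, Z] ≪≫ eqToIso _).inv = _
  simp [iso]

/-! ### Structure morphisms of the derived monoidal structure as realized arrows -/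

namespace Realizes

variable {A} {ι : Type*} {y : ι → Arrow C} {a b c d : Word ι}

theorem tensorHom {X X' Y Y' : C} {f : X ⟶ X'} {g : Y ⟶ Y'} (H : A.Realizes y a b (Arrow.mk f))
    (H' : A.Realizes y c d (Arrow.mk g)) : letI := A.monoidalStruct
    A.Realizes y (a.mul c) (b.mul d) (Arrow.mk (f ⊗ₘ g)) := by
  have := H.mul H'
  rwa [← arrow_mk_homPair] at this

theorem tensorObj {X Y : C} (H : A.Realizes y a a (Arrow.mk (𝟙 X)))
    (H' : A.Realizes y b b (Arrow.mk (𝟙 Y))) : letI := A.monoidalStruct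
    A.Realizes y (a.mul b) (a.mul b) (Arrow.mk (𝟙 (X ⊗ Y))) := by
  have := H.mul H'
  rwa [← arrow_mk_homPair, homPair_id, hom_id] at this

theorem unit : letI := A.monoidalStruct
    A.Realizes y .unit .unit (Arrow.mk (𝟙 (𝟙_ C))) := by
  have := Realizes.zero (A := A) (y := y)
  rwa [zero_arrow] at this

theorem associator {X Y Z : C} (H : A.Realizes y a a (Arrow.mk (𝟙 X)))
    (H' : A.Realizes y b b (Arrow.mk (𝟙 Y))) (H'' : A.Realizes y c c (Arrow.mk (𝟙 Z))) :
    letI := A.monoidalStruct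
    A.Realizes y ((a.mul b).mul c) (a.mul (b.mul c)) (Arrow.mk (α_ X Y Z).hom) := by
  have := H.leftRight H' H''
  rwa [← arrow_mk_associator] at this

theorem associator_inv {X Y Z : C} (H : A.Realizes y a a (Arrow.mk (𝟙 X)))
    (H' : A.Realizes y b b (Arrow.mk (𝟙 Y))) (H'' : A.Realizes y c c (Arrow.mk (𝟙 Z))) :
    letI := A.monoidalStruct
    A.Realizes y (a.mul (b.mul c)) ((a.mul b).mul c) (Arrow.mk (α_ X Y Z).inv) := by
  have := H.rightLeft H' H''
  rwa [← arrow_mk_associator_inv] at this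

/-- Realization sees words only through their reductions, so the identity of `X` also realizes the
unitor's pair of words; as arrows the two coincide. -/
theorem leftUnitor {X : C} (H : A.Realizes y a a (Arrow.mk (𝟙 X))) : letI := A.monoidalStruct
    A.Realizes y (Word.unit.mul a) a (Arrow.mk (λ_ X).hom) := by
  have := H.congr (a' := Word.unit.mul a) (one_mul a.reduce).symm rfl
  rw [← arrow_mk_id_congr (A.unit_tensor X),
    ← IsIdentity.arrow_eq (f := eqToHom (A.unit_tensor X)) ⟨_, rfl⟩] at this
  exact this

theorem rightUnitor {X : C} (H : A.Realizes y a a (Arrow.mk (𝟙 X))) : letI := A.monoidalStruct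
    A.Realizes y (a.mul Word.unit) a (Arrow.mk (ρ_ X).hom) := by
  have := H.congr (a' := a.mul Word.unit) (mul_one a.reduce).symm rfl
  rw [← arrow_mk_id_congr (A.tensor_unit X),
    ← IsIdentity.arrow_eq (f := eqToHom (A.tensor_unit X)) ⟨_, rfl⟩] at this
  exact this

/-- The principle behind the axioms below: both sides realize the same pair of words in distinct
letters. -/
theorem eq_of {X Y : C} {f g : X ⟶ Y} (ha : a.letters.Nodup) (H : A.Realizes y a b (Arrow.mk f))
    (H' : A.Realizes y a b (Arrow.mk g)) : f = g :=
  Arrow.mk_injective _ _ (H.unique ha H')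

end Realizes

/-- The monoidal structure given by an algebra. -/
@[reducible]
def monoidalCategory : MonoidalCategory C :=
  letI := A.monoidalStruct
  MonoidalCategory.ofTensorHom
    (id_tensorHom_id := fun X Y => by
      change A.hom mulOp mulOp (homPair (𝟙 X) (𝟙 Y)) = 𝟙 (A.obj mulOp ![X, Y])
      rw [homPair_id, hom_id])
    (id_tensorHom := fun _ _ _ _ => rfl)
    (tensorHom_id := fun _ _ => rfl)
    (tensorHom_comp_tensorHom := fun f f' g g' => by
      change A.hom mulOp mulOp (homPair f f') ≫ A.hom mulOp mulOp (homPair g g') =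
        A.hom mulOp mulOp (homPair (f ≫ g) (f' ≫ g'))
      rw [hom_comp, homPair_comp])
    (associator_naturality := fun f g h => by
      -- One letter per variable. `H` values the letters at the given morphisms, `Hl` and `Hr` at
      -- the identities of their sources and targets; the proof terms then follow the two sides of
      -- the axiom.
      have H : ∀ i, A.Realizes ![Arrow.mk f, Arrow.mk g, Arrow.mk h] (.of i) (.of i) _ :=
        fun i => .of _ i
      have Hl : ∀ i, A.Realizes (fun i => Arrow.mk (𝟙
        ((![Arrow.mk f, Arrow.mk g, Arrow.mk h] : Fin 3 → Arrow C) i).left)) (.of i) (.of i) _ :=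
        fun i => .of _ i
      have Hr : ∀ i, A.Realizes (fun i => Arrow.mk (𝟙
        ((![Arrow.mk f, Arrow.mk g, Arrow.mk h] : Fin 3 → Arrow C) i).right)) (.of i) (.of i) _ :=
        fun i => .of _ i
      exact Realizes.eq_of (by simp [Word.letters])
        ((((H 0).tensorHom (H 1)).tensorHom (H 2)).comp_right ((Hr 0).associator (Hr 1) (Hr 2)))
        (((Hl 0).associator (Hl 1) (Hl 2)).comp_left
          ((H 0).tensorHom ((H 1).tensorHom (H 2)))))
    (leftUnitor_naturality := fun f => by
      have H : ∀ i, A.Realizes ![Arrow.mk f] (.of i) (.of i) _ := fun i => .of _ i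
      have Hl : ∀ i, A.Realizes (fun i => Arrow.mk (𝟙
        ((![Arrow.mk f] : Fin 1 → Arrow C) i).left)) (.of i) (.of i) _ := fun i => .of _ i
      have Hr : ∀ i, A.Realizes (fun i => Arrow.mk (𝟙
        ((![Arrow.mk f] : Fin 1 → Arrow C) i).right)) (.of i) (.of i) _ := fun i => .of _ i
      exact Realizes.eq_of (by simp [Word.letters])
        ((Realizes.unit.tensorHom (H 0)).comp_right (Hr 0).leftUnitor)
        ((Hl 0).leftUnitor.comp_left (H 0)))
    (rightUnitor_naturality := fun f => by
      have H : ∀ i, A.Realizes ![Arrow.mk f] (.of i) (.of i) _ := fun i => .of _ i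
      have Hl : ∀ i, A.Realizes (fun i => Arrow.mk (𝟙
        ((![Arrow.mk f] : Fin 1 → Arrow C) i).left)) (.of i) (.of i) _ := fun i => .of _ i
      have Hr : ∀ i, A.Realizes (fun i => Arrow.mk (𝟙
        ((![Arrow.mk f] : Fin 1 → Arrow C) i).right)) (.of i) (.of i) _ := fun i => .of _ i
      exact Realizes.eq_of (by simp [Word.letters])
        (((H 0).tensorHom Realizes.unit).comp_right (Hr 0).rightUnitor)
        ((Hl 0).rightUnitor.comp_left (H 0)))
    (pentagon := fun W X Y Z => by
      have H : ∀ i, A.Realizes (fun i => Arrow.mk (𝟙 ((![W, X, Y, Z] : Fin 4 → C) i)))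
        (.of i) (.of i) _ := fun i => .of _ i
      exact Realizes.eq_of (by simp [Word.letters])
        ((((H 0).associator (H 1) (H 2)).tensorHom (H 3)).comp_right
          (((H 0).associator ((H 1).tensorObj (H 2)) (H 3)).comp_right
            ((H 0).tensorHom ((H 1).associator (H 2) (H 3)))))
        ((((H 0).tensorObj (H 1)).associator (H 2) (H 3)).comp_right
          ((H 0).associator (H 1) ((H 2).tensorObj (H 3)))))
    (triangle := fun X Y => by
      have H : ∀ i, A.Realizes (fun i => Arrow.mk (𝟙 ((![X, Y] : Fin 2 → C) i)))
        (.of i) (.of i) _ := fun i => .of _ i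
      exact Realizes.eq_of (by simp [Word.letters])
        (((H 0).associator Realizes.unit (H 1)).comp_right ((H 0).tensorHom (H 1).leftUnitor))
        ((H 0).rightUnitor.tensorHom (H 1)))

/-- The braiding given by an algebra. -/
def braidingIso (X Y : C) : A.obj mulOp ![X, Y] ≅ A.obj mulOp ![Y, X] :=
  A.iso mulOp swapOp ![X, Y] ≪≫ eqToIso (A.obj_swap X Y)

theorem arrow_mk_braidingIso (X Y : C) :
    Arrow.mk (A.braidingIso X Y).hom = A.arr mulOp swapOp ![Arrow.mk (𝟙 X), Arrow.mk (𝟙 Y)] := by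
  rw [A.arr_eq mulOp swapOp (fun i => 𝟙 (![X, Y] i)) _ (by intro i; fin_cases i <;> rfl)]
  simp [braidingIso, iso]

theorem Realizes.braidingIso {A : ELV₀.Algebra C} {ι : Type*} {y : ι → Arrow C} {a b : Word ι}
    {X Y : C} (H : A.Realizes y a a (Arrow.mk (𝟙 X))) (H' : A.Realizes y b b (Arrow.mk (𝟙 Y))) :
    A.Realizes y (a.mul b) (b.mul a) (Arrow.mk (A.braidingIso X Y).hom) := by
  have := H.mulSwap H'
  rwa [← arrow_mk_braidingIso] at this

/-- The symmetric structure given by an algebra. -/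
@[reducible]
def symmetricCategory : letI := A.monoidalCategory
    SymmetricCategory C :=
  letI := A.monoidalCategory
  { braiding := A.braidingIso
    braiding_naturality_right := fun X Y Z f => by
      have H : ∀ i, A.Realizes ![Arrow.mk (𝟙 X), Arrow.mk f] (.of i) (.of i) _ :=
        fun i => .of _ i
      have Hl : ∀ i, A.Realizes (fun i => Arrow.mk (𝟙
        ((![Arrow.mk (𝟙 X), Arrow.mk f] : Fin 2 → Arrow C) i).left)) (.of i) (.of i) _ :=
        fun i => .of _ i
      have Hr : ∀ i, A.Realizes (fun i => Arrow.mk (𝟙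
        ((![Arrow.mk (𝟙 X), Arrow.mk f] : Fin 2 → Arrow C) i).right)) (.of i) (.of i) _ :=
        fun i => .of _ i
      exact Realizes.eq_of (by simp [Word.letters])
        (((H 0).tensorHom (H 1)).comp_right ((Hr 0).braidingIso (Hr 1)))
        (((Hl 0).braidingIso (Hl 1)).comp_left ((H 1).tensorHom (H 0)))
    braiding_naturality_left := fun f Z => by
      have H : ∀ i, A.Realizes ![Arrow.mk f, Arrow.mk (𝟙 Z)] (.of i) (.of i) _ :=
        fun i => .of _ i
      have Hl : ∀ i, A.Realizes (fun i => Arrow.mk (𝟙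
        ((![Arrow.mk f, Arrow.mk (𝟙 Z)] : Fin 2 → Arrow C) i).left)) (.of i) (.of i) _ :=
        fun i => .of _ i
      have Hr : ∀ i, A.Realizes (fun i => Arrow.mk (𝟙
        ((![Arrow.mk f, Arrow.mk (𝟙 Z)] : Fin 2 → Arrow C) i).right)) (.of i) (.of i) _ :=
        fun i => .of _ i
      exact Realizes.eq_of (by simp [Word.letters])
        (((H 0).tensorHom (H 1)).comp_right ((Hr 0).braidingIso (Hr 1)))
        (((Hl 0).braidingIso (Hl 1)).comp_left ((H 1).tensorHom (H 0)))
    hexagon_forward := fun X Y Z => by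
      have H : ∀ i, A.Realizes (fun i => Arrow.mk (𝟙 ((![X, Y, Z] : Fin 3 → C) i)))
        (.of i) (.of i) _ := fun i => .of _ i
      exact Realizes.eq_of (by simp [Word.letters])
        (((H 0).associator (H 1) (H 2)).comp_right
          (((H 0).braidingIso ((H 1).tensorObj (H 2))).comp_right
            ((H 1).associator (H 2) (H 0))))
        ((((H 0).braidingIso (H 1)).tensorHom (H 2)).comp_right
          (((H 1).associator (H 0) (H 2)).comp_right
            ((H 1).tensorHom ((H 0).braidingIso (H 2)))))
    hexagon_reverse := fun X Y Z => by
      have H : ∀ i, A.Realizes (fun i => Arrow.mk (𝟙 ((![X, Y, Z] : Fin 3 → C) i)))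
        (.of i) (.of i) _ := fun i => .of _ i
      exact Realizes.eq_of (by simp [Word.letters])
        (((H 0).associator_inv (H 1) (H 2)).comp_right
          ((((H 0).tensorObj (H 1)).braidingIso (H 2)).comp_right
            ((H 2).associator_inv (H 0) (H 1))))
        (((H 0).tensorHom ((H 1).braidingIso (H 2))).comp_right
          (((H 0).associator_inv (H 2) (H 1)).comp_right
            (((H 0).braidingIso (H 2)).tensorHom (H 1))))
    symmetry := fun X Y => by
      have H : ∀ i, A.Realizes (fun i => Arrow.mk (𝟙 ((![X, Y] : Fin 2 → C) i)))
        (.of i) (.of i) _ := fun i => .of _ i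
      exact Realizes.eq_of (by simp [Word.letters])
        (((H 0).braidingIso (H 1)).comp_right ((H 1).braidingIso (H 0)))
        ((H 0).tensorObj (H 1)) }

/-- The strictly unital symmetric monoidal structure given by an algebra. -/
def symmMonoidal : SUSymmMonoidal C :=
  letI := A.monoidalCategory
  letI := A.symmetricCategory
  { strictlyUnital :=
      { unit_tensor := A.unit_tensor
        tensor_unit := A.tensor_unit
        leftUnitor_hom := fun _ => rfl
        rightUnitor_hom := fun _ => rfl } }

end CatOperad.Algebra

end OperadSMC

/-! ### The two constructions are mutually inverse -/

namespace OperadSMC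

open LV₀

theorem arrow_mk_inv_congr {C : Type*} [Category C] {X Y X' Y' : C} {e : X ≅ Y} {e' : X' ≅ Y'}
    (h : Arrow.mk e.hom = Arrow.mk e'.hom) : Arrow.mk e.inv = Arrow.mk e'.inv := by
  obtain ⟨rfl, rfl, h⟩ := (Arrow.mk_eq_mk_iff _ _).1 h
  obtain rfl : e = e' := Iso.ext (by simpa using h)
  rfl

/-- The `ELV₀`-algebra structure given by a strictly unital symmetric monoidal structure. -/
noncomputable def SUSymmMonoidal.algebra {C : Type u} [Category.{v} C] (S : SUSymmMonoidal C) :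
    ELV₀.Algebra C :=
  letI := S.monoidal
  letI := S.symmetric
  letI := S.strictlyUnital
  symmAlgebra C

namespace CatOperad.Algebra

variable {C : Type u} [Category.{v} C] (A : ELV₀.Algebra C)

theorem realizes_map {ι : Type*} {x y : ι → C} (f : ∀ i, x i ⟶ y i) (a : Word ι) :
    letI := A.monoidalCategory
    A.Realizes (fun i => Arrow.mk (f i)) a a (Arrow.mk (a.map f)) := by
  let _ := A.monoidalCategory
  induction a with
  | unit => exact Realizes.unit
  | of i => exact Realizes.of _ i
  | mul a b iha ihb => exact iha.tensorHom ihb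

theorem realizes_obj {ι : Type*} (x : ι → C) (a : Word ι) : letI := A.monoidalCategory
    A.Realizes (fun i => Arrow.mk (𝟙 (x i))) a a (Arrow.mk (𝟙 (a.obj x))) := by
  let _ := A.monoidalCategory
  rw [← Word.map_id]
  exact A.realizes_map _ a

/-- Over identities, exchanging the two operations inverts the action. -/
theorem realizes_inv {ι : Type*} {x : ι → C} {a b : Word ι} {X Y : C} {e : X ≅ Y}
    (H : A.Realizes (fun i => Arrow.mk (𝟙 (x i))) a b (Arrow.mk e.hom)) :
    A.Realizes (fun i => Arrow.mk (𝟙 (x i))) b a (Arrow.mk e.inv) := by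
  obtain ⟨n, l, p, q, hp, hq, h⟩ := H
  refine ⟨n, l, q, p, hq, hp, ?_⟩
  rw [A.arr_eq p q (fun i => 𝟙 (x (l i))) _ fun _ => rfl] at h
  rw [A.arr_eq q p (fun i => 𝟙 (x (l i))) _ fun _ => rfl]
  exact arrow_mk_inv_congr (e' := A.iso p q fun i => x (l i)) h

theorem realizes_eval {ι : Type*} (x : ι → C) {a b : Word ι} (p : Word.Path a b) :
    letI := A.monoidalCategory
    letI := A.symmetricCategory
    A.Realizes (fun i => Arrow.mk (𝟙 (x i))) a b (Arrow.mk (p.eval x)) := by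
  let _ := A.monoidalCategory
  let _ := A.symmetricCategory
  have H := A.realizes_obj x
  induction p with
  | id a => exact H a
  | comp p q ihp ihq => exact ihp.comp_right ihq
  | tensor p q ihp ihq => exact ihp.tensorHom ihq
  | assoc a b c => exact (H a).associator (H b) (H c)
  | assocInv a b c => exact (H a).associator_inv (H b) (H c)
  | left a => exact (H a).leftUnitor
  | leftInv a => exact A.realizes_inv (H a).leftUnitor
  | right a => exact (H a).rightUnitor
  | rightInv a => exact A.realizes_inv (H a).rightUnitor
  | braid a b => exact (H a).braidingIso (H b)

/-- The reconstructed action is a value of a word followed by the value of a path. It realizes the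
same pair of words as the original action, over the same arrows, and the letters are distinct. -/
theorem algebra_symmMonoidal : A.symmMonoidal.algebra = A := by
  refine CatOperad.Algebra.ext (funext fun n => Arrow.functor_ext fun X Y φ => ?_)
  let _ := A.monoidalCategory
  let _ := A.symmetricCategory
  let p : LV₀ n := X.1.as
  let q : LV₀ n := Y.1.as
  let x : Fin n → C := X.2
  let y : Fin n → C := Y.2
  let f : ∀ i, x i ⟶ y i := φ.2
  exact ((A.realizes_map f p.word).comp_right (A.realizes_eval y (p.path q))).unique
    p.nodup_letters (Realizes.word p q fun i => Arrow.mk (f i))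

theorem symmMonoidal_isInducedBy : A.symmMonoidal.IsInducedBy A := by
  let _ := A.monoidalCategory
  let _ := A.symmetricCategory
  have : OperadSMC.IsInducedBy A := {
    unit_eq := rfl
    tensor_eq := fun _ _ => rfl
    tensorHom_eq := fun f g => by
      exact ((Category.id_comp (X := A.obj mulOp ![_, _]) _).trans
        (Category.comp_id (A.hom mulOp mulOp (homPair f g)))).symm
    associator_eq := fun X Y Z => ⟨A.obj_left X Y Z, A.obj_right X Y Z, rfl⟩
    braiding_eq := fun X Y => ⟨rfl, A.obj_swap X Y,
      (Category.id_comp (A.braidingIso X Y).hom).symm⟩ }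
  exact this

end CatOperad.Algebra

/-- Strictly unital symmetric monoidal structures are equal if their products, units,
associativity and commutativity isomorphisms are. -/
theorem SUSymmMonoidal.ext_arrow {C : Type u} [Category.{v} C] {S T : SUSymmMonoidal C}
    (hO : ∀ X Y : C, S.monoidal.tensorObj X Y = T.monoidal.tensorObj X Y)
    (hU : S.monoidal.tensorUnit = T.monoidal.tensorUnit)
    (hH : ∀ {X X' Y Y' : C} (f : X ⟶ X') (g : Y ⟶ Y'),
      Arrow.mk (S.monoidal.tensorHom f g) = Arrow.mk (T.monoidal.tensorHom f g))
    (hα : ∀ X Y Z : C,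
      Arrow.mk (S.monoidal.associator X Y Z).hom = Arrow.mk (T.monoidal.associator X Y Z).hom)
    (hβ : ∀ X Y : C,
      Arrow.mk (S.symmetric.braiding X Y).hom = Arrow.mk (T.symmetric.braiding X Y).hom) :
    S = T := by
  have hL : ∀ (S : SUSymmMonoidal C) (X : C) {Y Y' : C} (f : Y ⟶ Y'),
      S.monoidal.whiskerLeft X f = S.monoidal.tensorHom (𝟙 X) f :=
    fun S X _ _ f => (@id_tensorHom C _ S.monoidal X _ _ f).symm
  have hR : ∀ (S : SUSymmMonoidal C) {X X' : C} (f : X ⟶ X') (Y : C),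
      S.monoidal.whiskerRight f Y = S.monoidal.tensorHom f (𝟙 Y) :=
    fun S _ _ f Y => (@tensorHom_id C _ S.monoidal _ _ f Y).symm
  have hLS := @hL S
  have hLT := @hL T
  have hRS := @hR S
  have hRT := @hR T
  clear hL hR
  -- Strict unitality fixes the unitors once products and unit are known, just as the whiskerings
  -- are fixed by the tensor product of morphisms.
  have hlS := S.strictlyUnital.leftUnitor_hom
  have hrS := S.strictlyUnital.rightUnitor_hom
  have hlT := T.strictlyUnital.leftUnitor_hom
  have hrT := T.strictlyUnital.rightUnitor_hom
  obtain @⟨@⟨⟨tO, wL, wR, tH, U, α, l, r⟩, _, _, _, _, _, _, _, _, _, _⟩, @⟨⟨β, _, _, _, _⟩, _⟩, _⟩ := S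
  obtain @⟨@⟨⟨tO', wL', wR', tH', U', α', l', r'⟩, _, _, _, _, _, _, _, _, _, _⟩,
    @⟨⟨β', _, _, _, _⟩, _⟩, _⟩ := T
  obtain rfl : tO = tO' := funext₂ hO
  obtain rfl : U = U' := hU
  obtain rfl : @tH = @tH' := by
    funext X X' Y Y' f g
    exact Arrow.mk_injective _ _ (hH f g)
  obtain rfl : @wL = @wL' := by
    funext X Y Y' f
    exact (hLS X f).trans (hLT X f).symm
  obtain rfl : @wR = @wR' := by
    funext X X' f Y
    exact (hRS f Y).trans (hRT f Y).symm
  obtain rfl : α = α' := by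
    funext X Y Z
    exact Iso.ext (Arrow.mk_injective _ _ (hα X Y Z))
  obtain rfl : l = l' := by
    funext X
    exact Iso.ext ((hlS X).trans (hlT X).symm)
  obtain rfl : r = r' := by
    funext X
    exact Iso.ext ((hrS X).trans (hrT X).symm)
  obtain rfl : β = β' := by
    funext X Y
    exact Iso.ext (Arrow.mk_injective _ _ (hβ X Y))
  rfl

/-- The chosen paths between the generating operations are replaced, by coherence, by the one-step
paths `id`, `assoc` and `braid`, whose values are the original structure. -/
theorem SUSymmMonoidal.symmMonoidal_algebra {C : Type u} [Category.{v} C] (S : SUSymmMonoidal C) :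
    S.algebra.symmMonoidal = S := by
  let _ := S.monoidal
  let _ := S.symmetric
  let _ := S.strictlyUnital
  refine SUSymmMonoidal.ext_arrow (fun X Y => rfl) rfl (fun {X X' Y Y'} f g => ?_)
    (fun X Y Z => ?_) (fun X Y => ?_)
  · change Arrow.mk (mulOp.word.map (homPair f g) ≫ (mulOp.path mulOp).eval ![X', Y']) =
      Arrow.mk (f ⊗ₘ g)
    rw [Word.Path.eval_eq _ mulOp.nodup_letters (mulOp.path mulOp) (.id _)]
    exact congrArg Arrow.mk (Category.comp_id _)
  · refine (S.algebra.arrow_mk_associator X Y Z).trans ?_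
    rw [S.algebra.arr_eq leftOp rightOp (fun i => 𝟙 (![X, Y, Z] i)) _
      (by intro i; fin_cases i <;> rfl)]
    change Arrow.mk (leftOp.word.map (fun i => 𝟙 (![X, Y, Z] i)) ≫
      (leftOp.path rightOp).eval ![X, Y, Z]) = _
    rw [Word.Path.eval_eq _ rightOp.nodup_letters (leftOp.path rightOp) (.assoc (.of 0) (.of 1)
      (.of 2)), Word.map_id, Category.id_comp]
    rfl
  · refine (S.algebra.arrow_mk_braidingIso X Y).trans ?_
    rw [S.algebra.arr_eq mulOp swapOp (fun i => 𝟙 (![X, Y] i)) _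
      (by intro i; fin_cases i <;> rfl)]
    change Arrow.mk (mulOp.word.map (fun i => 𝟙 (![X, Y] i)) ≫
      (mulOp.path swapOp).eval ![X, Y]) = _
    rw [Word.Path.eval_eq _ swapOp.nodup_letters (mulOp.path swapOp) (.braid (.of 0) (.of 1)),
      Word.map_id, Category.id_comp]
    rfl

/-! ### Maps -/

section

variable {C : Type u} {D : Type u} [Category.{v} C] [Category.{v} D]

theorem CatOperad.Algebra.IsMap.mapArrow_arr {A : ELV₀.Algebra C} {B : ELV₀.Algebra D} {F : C ⥤ D}
    (hF : A.IsMap B F) {n : ℕ} (p q : LV₀ n) (f : Fin n → Arrow C) :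
    F.mapArrow.obj (A.arr p q f) = B.arr p q fun i => F.mapArrow.obj (f i) :=
  congrArg (fun G => G.mapArrow.obj (Arrow.mk (CategoryTheory.Prod.mkHom
    (X₁ := (⟨p⟩ : ELV₀.Op n)) (X₂ := (⟨q⟩ : ELV₀.Op n))
    (Y₁ := fun i => (f i).left) (Y₂ := fun i => (f i).right) () (fun i => (f i).hom)))) (hF n)

/-- Tensor products of morphisms, associators and braidings are actions of operations up to
endpoints, so `F` preserves them as arrows; the transports in the conclusion come from unpacking
these equalities. -/
theorem CatOperad.Algebra.IsMap.isStrictMap {A : ELV₀.Algebra C} {B : ELV₀.Algebra D} {F : C ⥤ D}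
    (hF : A.IsMap B F) :
    letI := A.monoidalCategory
    letI := A.symmetricCategory
    letI := B.monoidalCategory
    letI := B.symmetricCategory
    IsStrictMap F := by
  let _ := A.monoidalCategory
  let _ := A.symmetricCategory
  let _ := B.monoidalCategory
  let _ := B.symmetricCategory
  have hU : F.obj (𝟙_ C) = 𝟙_ D := by
    have := hF.mapArrow_arr zeroOp zeroOp ![]
    rw [A.zero_arrow] at this
    refine (congrArg Comma.left this).trans (congrArg (B.obj zeroOp) ?_)
    funext i
    exact i.elim0
  have hH : ∀ {X X' Y Y' : C} (f : X ⟶ X') (g : Y ⟶ Y'),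
      Arrow.mk (F.map (f ⊗ₘ g)) = Arrow.mk (F.map f ⊗ₘ F.map g) := by
    intro X X' Y Y' f g
    have := hF.mapArrow_arr mulOp mulOp ![Arrow.mk f, Arrow.mk g]
    rw [← A.arrow_mk_homPair, B.arr_eq _ _ (homPair (F.map f) (F.map g)) _
      (by intro i; fin_cases i <;> rfl)] at this
    exact this
  have hO : ∀ X Y : C, F.obj (X ⊗ Y) = F.obj X ⊗ F.obj Y :=
    fun X Y => congrArg Comma.left (hH (𝟙 X) (𝟙 Y))
  have hα : ∀ X Y Z : C, Arrow.mk (F.map (α_ X Y Z).hom) =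
      Arrow.mk (α_ (F.obj X) (F.obj Y) (F.obj Z)).hom := by
    intro X Y Z
    refine ((congrArg F.mapArrow.obj (A.arrow_mk_associator X Y Z)).trans
      (hF.mapArrow_arr leftOp rightOp _)).trans
      (Eq.trans ?_ (B.arrow_mk_associator (F.obj X) (F.obj Y) (F.obj Z)).symm)
    congr 1
    funext i
    fin_cases i <;> exact congrArg Arrow.mk (F.map_id _)
  have hβ : ∀ X Y : C, Arrow.mk (F.map (β_ X Y).hom) =
      Arrow.mk (β_ (F.obj X) (F.obj Y)).hom := by
    intro X Y
    refine ((congrArg F.mapArrow.obj (A.arrow_mk_braidingIso X Y)).trans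
      (hF.mapArrow_arr mulOp swapOp _)).trans
      (Eq.trans ?_ (B.arrow_mk_braidingIso (F.obj X) (F.obj Y)).symm)
    congr 1
    funext i
    fin_cases i <;> exact congrArg Arrow.mk (F.map_id _)
  refine ⟨hU, hO, fun f g => ?_, fun X Y Z => ?_, fun X => ?_, fun X => ?_, fun X Y => ?_⟩
  · obtain ⟨_, _, h⟩ := (Arrow.mk_eq_mk_iff _ _).1 (hH f g)
    exact h
  · obtain ⟨_, _, h⟩ := (Arrow.mk_eq_mk_iff _ _).1 (hα X Y Z)
    exact h
  -- The unitors are transports on both sides, and functors preserve these.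
  · refine (eqToHom_map F (A.unit_tensor X)).trans (Eq.symm ?_)
    exact eqToHom_trans _ (B.unit_tensor (F.obj X))
  · refine (eqToHom_map F (A.tensor_unit X)).trans (Eq.symm ?_)
    exact eqToHom_trans _ (B.tensor_unit (F.obj X))
  · obtain ⟨_, _, h⟩ := (Arrow.mk_eq_mk_iff _ _).1 (hβ X Y)
    exact h

variable [MonoidalCategory C] [SymmetricCategory C] [MonoidalCategory D] [SymmetricCategory D]

namespace IsStrictMap

variable {F : C ⥤ D} {ι : Type*}

theorem map_obj (hF : IsStrictMap F) (x : ι → C) (a : Word ι) : F.obj (a.obj x) = a.obj fun i => F.obj (x i) := by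
  induction a with
  | unit => exact hF.map_unit
  | of i => rfl
  | mul a b iha ihb => exact (hF.map_tensor _ _).trans (congrArg₂ (· ⊗ ·) iha ihb)

theorem arrow_mk_map_tensorHom (hF : IsStrictMap F) {X X' Y Y' : C} (f : X ⟶ X') (g : Y ⟶ Y') :
    Arrow.mk (F.map (f ⊗ₘ g)) = Arrow.mk (F.map f) * Arrow.mk (F.map g) := by
  rw [hF.map_tensorHom]
  simp [arrow_mk_mul]

theorem arrow_mk_map_map (hF : IsStrictMap F) {x y : ι → C} (f : ∀ i, x i ⟶ y i) (a : Word ι) :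
    Arrow.mk (F.map (a.map f)) = Arrow.mk (a.map fun i => F.map (f i)) := by
  induction a with
  | unit =>
    exact (congrArg Arrow.mk (F.map_id _)).trans (arrow_mk_id_congr hF.map_unit)
  | of i => rfl
  | mul a b iha ihb =>
    exact (hF.arrow_mk_map_tensorHom _ _).trans (congrArg₂ (· * ·) iha ihb)

theorem arrow_mk_map_eval (hF : IsStrictMap F) (x : ι → C) {a b : Word ι} (p : Word.Path a b) :
    Arrow.mk (F.map (p.eval x)) = Arrow.mk (p.eval fun i => F.obj (x i)) := by
  have hα : ∀ a b c : Word ι, Arrow.mk (F.map (α_ (a.obj x) (b.obj x) (c.obj x)).hom) =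
      Arrow.mk (α_ (a.obj fun i => F.obj (x i)) (b.obj fun i => F.obj (x i))
        (c.obj fun i => F.obj (x i))).hom := by
    intro a b c
    rw [hF.map_associator, Arrow.arrow_mk_eqToHom_comp, Arrow.arrow_mk_comp_eqToHom]
    exact _root_.congr (_root_.congr (congrArg (fun X Y Z : D => Arrow.mk (α_ X Y Z).hom)
      (hF.map_obj x a)) (hF.map_obj x b)) (hF.map_obj x c)
  have hl : ∀ a : Word ι, Arrow.mk (F.map (λ_ (a.obj x)).hom) =
      Arrow.mk (λ_ (a.obj fun i => F.obj (x i))).hom := by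
    intro a
    rw [hF.map_leftUnitor, Arrow.arrow_mk_eqToHom_comp]
    exact congrArg (fun X : D => Arrow.mk (λ_ X).hom) (hF.map_obj x a)
  have hr : ∀ a : Word ι, Arrow.mk (F.map (ρ_ (a.obj x)).hom) =
      Arrow.mk (ρ_ (a.obj fun i => F.obj (x i))).hom := by
    intro a
    rw [hF.map_rightUnitor, Arrow.arrow_mk_eqToHom_comp]
    exact congrArg (fun X : D => Arrow.mk (ρ_ X).hom) (hF.map_obj x a)
  induction p with
  | id a => exact (congrArg Arrow.mk (F.map_id _)).trans (arrow_mk_id_congr (hF.map_obj x a))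
  | comp p q ihp ihq =>
    exact (congrArg Arrow.mk (F.map_comp _ _)).trans (arrow_mk_comp_congr ihp ihq)
  | tensor p q ihp ihq =>
    exact (hF.arrow_mk_map_tensorHom _ _).trans (congrArg₂ (· * ·) ihp ihq)
  | assoc a b c => exact hα a b c
  | assocInv a b c => exact arrow_mk_inv_congr (e := F.mapIso (α_ _ _ _)) (hα a b c)
  | left a => exact hl a
  | leftInv a => exact arrow_mk_inv_congr (e := F.mapIso (λ_ _)) (hl a)
  | right a => exact hr a
  | rightInv a => exact arrow_mk_inv_congr (e := F.mapIso (ρ_ _)) (hr a)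
  | braid a b =>
    simp only [Word.Path.eval]
    rw [hF.map_braiding, Arrow.arrow_mk_eqToHom_comp, Arrow.arrow_mk_comp_eqToHom]
    exact congrArg₂ (fun X Y : D => Arrow.mk (β_ X Y).hom) (hF.map_obj x a) (hF.map_obj x b)

/-- The chosen path depends only on the operations and not on the category, so `C` and `D` evaluate
the same path, whose value `F` preserves. -/
theorem isMap [IsStrictlyUnital C] [IsStrictlyUnital D] (hF : IsStrictMap F) :
    (symmAlgebra C).IsMap (symmAlgebra D) F := by
  intro n
  refine Arrow.functor_ext fun X Y φ => ?_
  let p : LV₀ n := X.1.as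
  let q : LV₀ n := Y.1.as
  exact (congrArg Arrow.mk (F.map_comp _ _)).trans
    (arrow_mk_comp_congr (hF.arrow_mk_map_map φ.2 p.word) (hF.arrow_mk_map_eval Y.2 (p.path q)))

end IsStrictMap

end

/-! ### The isomorphism of categories -/

/-- The round trip fixes objects only propositionally, so morphisms with the same underlying functor
have to be compared heterogeneously. -/
theorem AlgebraCat.hom_heq {O : CatOperad.{w, t}} {C D : Type u} [Category.{v} C] [Category.{v} D]
    {A A' : O.Algebra C} {B B' : O.Algebra D} (hA : A = A') (hB : B = B') (F : C ⥤ D)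
    (h : A.IsMap B F) (h' : A'.IsMap B' F) :
    (AlgebraCat.Hom.mk F h : AlgebraCat.Hom ⟨C, A⟩ ⟨D, B⟩) ≍
      (AlgebraCat.Hom.mk F h' : AlgebraCat.Hom ⟨C, A'⟩ ⟨D, B'⟩) := by
  subst hA hB
  rfl

theorem SUSymmMonCat.hom_heq {C D : Type u} [Category.{v} C] [Category.{v} D]
    {S S' : SUSymmMonoidal C} {T T' : SUSymmMonoidal D} (hS : S = S') (hT : T = T')
    (f : SUSymmMonCat.Hom ⟨C, S⟩ ⟨D, T⟩) (f' : SUSymmMonCat.Hom ⟨C, S'⟩ ⟨D, T'⟩)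
    (h : f.functor = f'.functor) : f ≍ f' := by
  subst hS hT
  exact heq_of_eq (SUSymmMonCat.Hom.ext h)

/-- The functor from `ELV₀`-algebras to strictly unital symmetric monoidal categories. -/
def algebraToSymm : AlgebraCat.{0, 0, v, u} ELV₀ ⥤ SUSymmMonCat.{v, u} where
  obj X := { carrier := X.carrier, str := X.str.symmMonoidal }
  map f := ⟨f.functor, f.isMap.isStrictMap⟩

/-- The functor from strictly unital symmetric monoidal categories to `ELV₀`-algebras. -/
noncomputable def symmToAlgebra : SUSymmMonCat.{v, u} ⥤ AlgebraCat.{0, 0, v, u} ELV₀ where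
  obj X := { carrier := X.carrier, str := X.str.algebra }
  map f := ⟨f.functor, f.isStrict.isMap⟩

theorem algebraToSymm_comp_symmToAlgebra :
    algebraToSymm.{v, u} ⋙ symmToAlgebra = 𝟭 (AlgebraCat.{0, 0, v, u} ELV₀) := by
  refine Functor.hext (fun X => ?_) fun X Y f => ?_
  · exact congrArg (fun A : ELV₀.Algebra X.carrier => (⟨X.carrier, A⟩ : AlgebraCat ELV₀))
      X.str.algebra_symmMonoidal
  · exact AlgebraCat.hom_heq X.str.algebra_symmMonoidal Y.str.algebra_symmMonoidal f.functor _ _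

theorem symmToAlgebra_comp_algebraToSymm :
    symmToAlgebra.{v, u} ⋙ algebraToSymm = 𝟭 SUSymmMonCat.{v, u} := by
  refine Functor.hext (fun X => ?_) fun X Y f => ?_
  · exact congrArg (fun S : SUSymmMonoidal X.carrier => (⟨X.carrier, S⟩ : SUSymmMonCat))
      X.str.symmMonoidal_algebra
  · exact SUSymmMonCat.hom_heq X.str.symmMonoidal_algebra Y.str.symmMonoidal_algebra _ _ rfl

/-- The bijection between `ELV₀`-algebra structures and strictly unital symmetric monoidal
structures. -/
noncomputable def algebraEquiv (C : Type u) [Category.{v} C] :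
    ELV₀.Algebra C ≃ SUSymmMonoidal C where
  toFun A := A.symmMonoidal
  invFun S := S.algebra
  left_inv A := A.algebra_symmMonoidal
  right_inv S := S.symmMonoidal_algebra

end OperadSMC

theorem mainTheorem5 :
    ∃ Φ : ∀ (C : Type u) [Category.{v} C],
        OperadSMC.ELV₀.Algebra C ≃ OperadSMC.SUSymmMonoidal C,
      (∀ (C : Type u) [Category.{v} C] (A : OperadSMC.ELV₀.Algebra C),
        (Φ C A).IsInducedBy A) ∧
      ∃ (F : OperadSMC.AlgebraCat.{0, 0, v, u} OperadSMC.ELV₀ ⥤ OperadSMC.SUSymmMonCat.{v, u})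
        (G : OperadSMC.SUSymmMonCat.{v, u} ⥤ OperadSMC.AlgebraCat.{0, 0, v, u} OperadSMC.ELV₀),
        F ⋙ G = 𝟭 (OperadSMC.AlgebraCat.{0, 0, v, u} OperadSMC.ELV₀) ∧
        G ⋙ F = 𝟭 OperadSMC.SUSymmMonCat.{v, u} ∧
        (∀ X, F.obj X = { carrier := X.carrier, str := Φ X.carrier X.str }) ∧
        F ⋙ OperadSMC.SUSymmMonCat.forget = OperadSMC.AlgebraCat.forget OperadSMC.ELV₀ :=
  ⟨fun C _ => OperadSMC.algebraEquiv C, fun _ _ A => A.symmMonoidal_isInducedBy,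
    OperadSMC.algebraToSymm, OperadSMC.symmToAlgebra,
    OperadSMC.algebraToSymm_comp_symmToAlgebra, OperadSMC.symmToAlgebra_comp_algebraToSymm,
    -- Both functors keep the carrier and the underlying functors, so the compatibilities hold by
    -- definition.
    fun _ => rfl, rfl⟩
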